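/- Let $n,k\ge 1$ and $[n]=\{1,\dots,n\}$. A *weighted partition* of $[n]$ with $k$ layers is a sequence $\pi=(\pi^{(1)},\dots,\pi^{(k)})$ of set partitions of $[n]$ in which $\pi^{(l+1)}$ refines $\pi^{(l)}$ for $1\le l<k$. (In the usual notation, singleton blocks of the layers $l\ge 2$ are left out, so that written blocks in these layers have at least two elements.) Put $\rho(\pi)=n-\#\{\text{blocks of }\pi^{(1)}\}$. For integers $1\le\alpha<\beta\le n$ and $l\in[k]$ write $\pi\xrightarrow{(\alpha,\beta)_l}\pi'$ if $\beta$ is the least element of its block in $\pi^{(1)}$, $\alpha$ lies in a different block of $\pi^{(1)}$, $\alpha$ and $\beta$ are the least elements of their (different) blocks in $\pi^{(l)}$, and $\pi'$ is obtained from $\pi$ by merging the block of $\alpha$ with the block of $\beta$ in every layer $m\le l$ and leaving the layers $m>l$ unchanged. Let $\mathcal P_n^{(k)}$ be the set of weighted partitions, ordered by: $\pi\le\pi'$ if there is a finite (possibly empty) sequence of such steps from $\pi$ to $\pi'$. Let $\mathcal L_n^{(k)}$ be the poset obtained from $\mathcal P_n^{(k)}$ by adding a greatest element $\hat 1$, put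 $\rho(\hat 1)=n$, and write $\pi\xrightarrow{(1,n)_k}\hat 1$ for all $\pi$ with $\rho(\pi)=n-1$. Order the labels totally by: $(\alpha,\beta)_l<(\alpha',\beta')_{l'}$ if $l>l'$, or $l=l'$ and $\alpha<\alpha'$, or $l=l'$, $\alpha=\alpha'$ and $\beta<\beta'$. An *EL-labeling* of a finite bounded graded poset $P$ is a map $\lambda$ from its covering relations to a poset such that (i) every interval $[x,y]$ of $P$ has exactly one rising maximal chain $x=x_0\lessdot x_1\lessdot\dots\lessdot x_m=y$, rising meaning $\lambda(x_{i-1},x_i)\le\lambda(x_i,x_{i+1})$ for $1\le i<m$; and (ii) for this chain, $\lambda(x,x_1)<\lambda(x,z)$ whenever $x\lessdot z\le y$ and $z\ne x_1$. A finite bounded graded poset with an EL-labeling is *EL-shellable*. A finite poset is *shellable* if its maximal chains, viewed as sets, all have the same size and can be listed as $F_1,\dots,F_t$ such that for all $i<j$ there are $l<j$ and $v\in F_j$ with $F_i\cap F_j\subseteq F_l\cap F_j=F_j\setminus\{v\}$. A graded poset with rank function $\rho$ is *Cohen–Macaulay* over a ring $R$ if, for all $x<y$ and all $i\ne\rho(y)-\rho(x)-2$,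 the reduced homology $\tilde H_i((x,y),R)$ of the order complex of the open interval $(x,y)$ vanishes. **Theorem.** The covering relations of $\mathcal L_n^{(k)}$ are exactly the pairs joined by an arrow above, and each carries exactly one label. The resulting edge labeling is an EL-labeling of $\mathcal L_n^{(k)}$, and in each interval the unique rising maximal chain is lexicographically first: its label word is strictly smaller in lexicographic order than that of every other maximal chain of the interval. The poset $\mathcal L_n^{(k)}$ is finite, bounded and graded with rank function $\rho$. Consequently it is EL-shellable, hence shellable, and it is Cohen–Macaulay over $\mathbb Z$ and over every field. -/

import Mathlib

/-- The partition obtained from `s` by merging the block of `a` with the block of `b`. -/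
def mergeBlocks {X : Type*} (s : Setoid X) (a b : X) : Setoid X where
  r u v := s u v ∨ (s u a ∧ s v b) ∨ (s u b ∧ s v a)
  iseqv :=
    { refl := fun u => Or.inl (s.refl' u)
      symm := by
        rintro u v (h | ⟨h₁, h₂⟩ | ⟨h₁, h₂⟩)
        · exact Or.inl (s.symm' h)
        · exact Or.inr (Or.inr ⟨h₂, h₁⟩)
        · exact Or.inr (Or.inl ⟨h₂, h₁⟩)
      trans := by
        rintro u v w (h | ⟨h₁, h₂⟩ | ⟨h₁, h₂⟩) (h' | ⟨h₁', h₂'⟩ | ⟨h₁', h₂'⟩)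
        · exact Or.inl (s.trans' h h')
        · exact Or.inr (Or.inl ⟨s.trans' h h₁', h₂'⟩)
        · exact Or.inr (Or.inr ⟨s.trans' h h₁', h₂'⟩)
        · exact Or.inr (Or.inl ⟨h₁, s.trans' (s.symm' h') h₂⟩)
        · exact Or.inl (s.trans' h₁ (s.trans' (s.symm' h₁')
            (s.trans' h₂ (s.symm' h₂'))))
        · exact Or.inl (s.trans' h₁ (s.symm' h₂'))
        · exact Or.inr (Or.inr ⟨h₁, s.trans' (s.symm' h') h₂⟩)
        · exact Or.inl (s.trans' h₁ (s.symm' h₂'))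
        · exact Or.inl (s.trans' h₁ (s.trans' (s.symm' h₁')
            (s.trans' h₂ (s.symm' h₂')))) }

/-- A weighted partition of `[n]` with `k` layers. The elements `0, …, n - 1` of `Fin n` stand
for the integers `1, …, n`, and the elements `0, …, k - 1` of `Fin k` for the layers `1, …, k`.
Each layer is a partition of `[n]`, and every layer refines the layers before it.
In one-line notation a singleton block of a layer `≥ 2` is not written (it is an "empty block"),
so that the blocks written in the layers `≥ 2` have at least two elements. -/
@[ext] structure WeightedPartition (n k : ℕ) where
  layer : Fin k → Setoid (Fin n)
  antitone : Antitone layer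

namespace WeightedPartition

variable {n k : ℕ}

/-- The rank `ρ(π) = n - #{blocks of the first layer of π}`. -/
noncomputable def rank [NeZero k] (x : WeightedPartition n k) : ℕ :=
  n - Nat.card (Quotient (x.layer 0))

/-- The covering relation `x → y` with label `(a, b)_l`: `b` is the least element of its block in
the first layer of `x`, and `a` does not lie in that block; in the `l`-th layer, `a < b` are the
least elements of two different blocks. Connecting `a` with `b` by a line labelled `l` merges the
blocks of `a` and `b` in the layers `m ≤ l`, and leaves the layers `m > l` as they are. -/
structure Admissible [NeZero k] (x : WeightedPartition n k) (a b : Fin n) (l : Fin k)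
    (y : WeightedPartition n k) : Prop where
  lt : a < b
  ne_first : ¬ x.layer 0 a b
  least_first : ∀ c, x.layer 0 c b → b ≤ c
  ne_layer : ¬ x.layer l a b
  least_left : ∀ c, x.layer l c a → a ≤ c
  least_right : ∀ c, x.layer l c b → b ≤ c
  layer_of_le : ∀ m, m ≤ l → y.layer m = mergeBlocks (x.layer m) a b
  layer_of_lt : ∀ m, l < m → y.layer m = x.layer m

/-- `y` is obtained from `x` by one admissible merge. -/
def Step [NeZero k] (x y : WeightedPartition n k) : Prop :=
  ∃ a b l, Admissible x a b l y

theorem Step.layer_zero_lt [NeZero k] {x y : WeightedPartition n k} (h : Step x y) :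
    x.layer 0 < y.layer 0 := by
  obtain ⟨a, b, l, h⟩ := h
  have h0 := h.layer_of_le 0 (Fin.zero_le l)
  rw [h0]
  refine lt_of_le_of_ne (fun u v huv => Or.inl huv) (fun he => h.ne_first ?_)
  rw [he]
  exact Or.inr (Or.inl ⟨(x.layer 0).refl' a, (x.layer 0).refl' b⟩)

theorem layer_zero_le [NeZero k] {x y : WeightedPartition n k}
    (h : Relation.ReflTransGen Step x y) : x.layer 0 ≤ y.layer 0 := by
  induction h with
  | refl => exact le_rfl
  | tail _ hs ih => exact ih.trans hs.layer_zero_lt.le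

/-- `x ≤ y` if there is a chain of covering relations `x = x₀ ⋖ x₁ ⋖ ⋯ ⋖ x_m = y`. -/
instance [NeZero k] : PartialOrder (WeightedPartition n k) where
  le x y := Relation.ReflTransGen Step x y
  le_refl _ := Relation.ReflTransGen.refl
  le_trans _ _ _ := Relation.ReflTransGen.trans
  le_antisymm x y hxy hyx := by
    rcases Relation.ReflTransGen.cases_head hxy with h | ⟨z, hs, hz⟩
    · exact h
    · exact absurd (hs.layer_zero_lt.trans_le ((layer_zero_le hz).trans (layer_zero_le hyx)))
        (lt_irrefl _)

end WeightedPartition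

/-- The poset `L_n^{(k)}`: weighted partitions with an added greatest element. -/
abbrev LPoset (n k : ℕ) : Type := WithTop (WeightedPartition n k)

/-- The rank function of `L_n^{(k)}`; the added greatest element has rank `n`. -/
noncomputable def LPoset.rank {n k : ℕ} [NeZero k] : LPoset n k → ℕ
  | none => n
  | some x => WeightedPartition.rank x

/-- Labels `(α, β)_l`, totally ordered: higher layer `l` first, then by `α`, then by `β`. -/
abbrev EdgeLabel : Type := ℕᵒᵈ ×ₗ (ℕ ×ₗ ℕ)

/-- The label `(α, β)_l`. -/
def EdgeLabel.mk (α β l : ℕ) : EdgeLabel := toLex (OrderDual.toDual l, toLex (α, β))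

/-- `HasLabel x y c`: there is a covering relation from `x` to `y` with label `c`. The covering
relations `π → 1̂`, where `π` has rank `n - 1`, are all labelled `(1, n)_k`. -/
def HasLabel {n k : ℕ} [NeZero k] : LPoset n k → LPoset n k → EdgeLabel → Prop
  | some x, some y, c => ∃ (a b : Fin n) (l : Fin k),
      WeightedPartition.Admissible x a b l y ∧ c = EdgeLabel.mk (a + 1) (b + 1) (l + 1)
  | some x, none, c => WeightedPartition.rank x + 1 = n ∧ c = EdgeLabel.mk 1 n k
  | none, _, _ => False

instance : Nonempty EdgeLabel := ⟨EdgeLabel.mk 0 0 0⟩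

/-- The edge labeling of `L_n^{(k)}`: the label of the covering relation from `x` to `y`
(a dummy value if there is none). -/
noncomputable def wpEdgeLabel (n k : ℕ) [NeZero k] (x y : LPoset n k) : EdgeLabel :=
  Classical.epsilon (HasLabel x y)

section ELLabeling

variable {P : Type*} [PartialOrder P] {Λ : Type*} [PartialOrder Λ]

/-- `c` is an unrefinable chain `x = x₀ ⋖ x₁ ⋖ ⋯ ⋖ x_m = y`, that is, a maximal chain of the
interval `[x, y]`. -/
def IsUnrefinableChain (x y : P) (c : List P) : Prop :=
  c.IsChain (· ⋖ ·) ∧ c.head? = some x ∧ c.getLast? = some y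

/-- The word `lam(x₀, x₁), lam(x₁, x₂), …` of labels along a chain. An edge labeling is given by
a function of pairs, of which only the values on covering pairs are used. -/
def labelWord (lam : P → P → Λ) (c : List P) : List Λ := List.zipWith lam c c.tail

/-- The labels weakly increase along the chain. -/
def IsRisingChain (lam : P → P → Λ) (c : List P) : Prop := (labelWord lam c).IsChain (· ≤ ·)

/-- `lam` is an EL-labeling. -/
structure IsELLabeling (lam : P → P → Λ) : Prop where
  existsUnique_rising : ∀ x y : P, x ≤ y →
    ∃! c : List P, IsUnrefinableChain x y c ∧ IsRisingChain lam c
  first_label_lt : ∀ (x y x₁ : P) (t : List P),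
    IsUnrefinableChain x y (x :: x₁ :: t) → IsRisingChain lam (x :: x₁ :: t) →
    ∀ z, x ⋖ z → z ≤ y → z ≠ x₁ → lam x x₁ < lam x z

/-- `ρ` is the rank function of the poset. -/
structure IsRankFunction (ρ : P → ℕ) : Prop where
  minimal : ∀ x, IsMin x → ρ x = 0
  covBy : ∀ x y, x ⋖ y → ρ y = ρ x + 1

variable (P)

/-- Finite bounded graded posets. -/
def IsGradedPoset : Prop :=
  Finite P ∧ (∃ b : P, IsBot b) ∧ (∃ t : P, IsTop t) ∧ ∃ ρ : P → ℕ, IsRankFunction ρ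

/-- EL-shellable (lexicographically shellable) posets. -/
def IsELShellable : Prop :=
  IsGradedPoset P ∧ ∃ (Λ : Type) (_ : PartialOrder Λ) (lam : P → P → Λ), IsELLabeling lam

/-- Shellability of (the order complex of) a poset: the maximal chains all have the same finite
size, and they can be listed as `F₀, …, F_{t-1}` such that for all `i < j` there are `l < j` and
`v ∈ F_j` with `F_i ∩ F_j ⊆ F_l ∩ F_j = F_j \ {v}`. -/
def IsShellablePoset : Prop :=
  ∃ (t : ℕ) (F : Fin t → Set P), Function.Injective F ∧
    (∀ c : Set P, IsMaxChain (· ≤ ·) c ↔ c ∈ Set.range F) ∧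
    (∃ d : ℕ, ∀ i, (F i).Finite ∧ (F i).ncard = d) ∧
    ∀ i j, i < j → ∃ l, l < j ∧ ∃ v ∈ F j, F i ∩ F j ⊆ F l ∩ F j ∧ F l ∩ F j = F j \ {v}

end ELLabeling

section OrderHomology

/-- The quotient `Z / B` of a module of cycles by a module of boundaries. -/
abbrev CyclesModBoundaries {R M : Type*} [Ring R] [AddCommGroup M] [Module R M]
    (Z B : Submodule R M) : Type _ := Z ⧸ B.submoduleOf Z

variable (R : Type*) [CommRing R] (P : Type*) [PartialOrder P]

/-- Simplicial chains of the order complex: the free module on the chains with `m` elements,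
which are the simplices of dimension `m - 1` (the empty simplex if `m = 0`). -/
abbrev OrderChains (m : ℕ) : Type _ := (Fin m ↪o P) →₀ R

/-- The boundary map `v₀ < ⋯ < v_m ↦ ∑_j (-1)^j (v₀ < ⋯ < v̂_j < ⋯ < v_m)`; for `m = 0` this is
the augmentation. -/
noncomputable def orderBoundary (m : ℕ) : OrderChains R P (m + 1) →ₗ[R] OrderChains R P m :=
  Finsupp.linearCombination R fun c : Fin (m + 1) ↪o P =>
    ∑ j : Fin (m + 1), Finsupp.single ((Fin.succAboveOrderEmb j).trans c) ((-1 : R) ^ (j : ℕ))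

/-- Cycles of the reduced chain complex, spanned by chains with `m` elements. -/
noncomputable def orderCycles : (m : ℕ) → Submodule R (OrderChains R P m)
  | 0 => ⊤
  | m + 1 => LinearMap.ker (orderBoundary R P m)

/-- The reduced order homology `H̃_{m-1}(P, R)`, in degree `m - 1`. -/
abbrev ReducedOrderHomology (m : ℕ) : Type _ :=
  CyclesModBoundaries (orderCycles R P m) (LinearMap.range (orderBoundary R P m))

variable {P}

/-- Cohen–Macaulayness over `R` of a poset with rank function `ρ`: for `x < y`, the open interval
`(x, y)` has `H̃_i((x, y), R) = 0` for `i ≠ ρ(y) - ρ(x) - 2` (here `i = m - 1`). -/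
def IsCohenMacaulayPoset (ρ : P → ℕ) : Prop :=
  ∀ x y : P, x < y → ∀ m : ℕ, (m : ℤ) - 1 ≠ (ρ y : ℤ) - (ρ x : ℤ) - 2 →
    Subsingleton (ReducedOrderHomology R (Set.Ioo x y) m)

end OrderHomology

/-!
Shellability and Cohen-Macaulayness follow from the EL-labeling, so the theorem has two halves.

*The labeling.* Along a chain of weighted partitions, a step labelled `(a, b)_l` removes exactly
one block minimum from the first layer, namely `b`. Hence, in an interval `[x, y]` with `y ≠ 1̂`,
the second entries of the labels of a maximal chain are the minima `b` of blocks of the first layer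
of `x` which are no longer minima in `y`. The layer `l` belonging to `b` depends on `y` only: it is
the last layer of `y` in which `b` is not a block minimum. The first entry is at least the minimum
`a` of the block of `b` in this layer of `y`. So every step of `[x, y]` has a label at least the
"final label" `(a, b)_l` of its `b` (`FinalLabel`, `Admissible.exists_finalLabel`). Two consecutive
steps can be interchanged (`Admissible.swap`), and therefore a chain from `x` to `y` can begin with
any of these `b` (`exists_admissible_of_le`); if the final label of `b` is the least one, such a
first step must carry exactly this label (`left_eq_of_least`). Thus the rising chain consists of the
final labels in increasing order. A chain which starts with another atom is not rising, because the
least final label is still to come. For `y = 1̂` the same role is played by the labels `(1, b)_k`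
followed by `(1, n)_k`. The criterion `isELLabeling_of_labelSets` turns this into the EL-property.

*Consequences.* If a maximal chain `c'` of an interval has all its descents on another maximal chain
`c`, then `c'` is lexicographically before `c` (`IsELLabeling.eq_or_lex_of_descents`). Otherwise `c'`
has a descent outside `c`, and exchanging it gives a lexicographically smaller chain that differs
from `c'` in this vertex only (`IsELLabeling.exists_exchange`). So the lexicographic order is a
shelling, of the poset and of each of its intervals.

The homology of a shelled complex is computed by gluing on the facets one at a time. Either the new
faces of a facet can be paired off by adding and removing a fixed vertex, so that every cycle is
homologous to one avoiding these faces (`exists_sub_orderBoundary_supported`), or the only new face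
is the facet itself, which has the top dimension. By induction on the number of facets, all cycles
below the top dimension are boundaries (`orderCycles_le_range_of_shelling`).
-/

/-! ### Unrefinable chains as lists -/

section ChainLists

variable {P : Type*} [PartialOrder P] {Λ : Type*}

theorem IsUnrefinableChain.singleton (x : P) : IsUnrefinableChain x x [x] :=
  ⟨List.isChain_singleton _, rfl, rfl⟩

theorem isUnrefinableChain_singleton_iff {x y z : P} :
    IsUnrefinableChain x y [z] ↔ z = x ∧ z = y := by
  simp [IsUnrefinableChain]

theorem isUnrefinableChain_cons_cons {x y a z : P} {t : List P} :
    IsUnrefinableChain x y (a :: z :: t) ↔ a = x ∧ a ⋖ z ∧ IsUnrefinableChain z y (z :: t) := by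
  simp [IsUnrefinableChain, List.isChain_cons_cons, List.getLast?_cons_cons]
  tauto

theorem IsUnrefinableChain.eq_cons {x y : P} {c : List P} (h : IsUnrefinableChain x y c) :
    ∃ t, c = x :: t := by
  obtain ⟨-, h, -⟩ := h
  cases c with
  | nil => simp at h
  | cons a t => exact ⟨t, by simpa using h⟩

theorem IsUnrefinableChain.cases {x y : P} {c : List P} (h : IsUnrefinableChain x y c) :
    (x = y ∧ c = [x]) ∨ ∃ z t, c = x :: z :: t ∧ x ⋖ z ∧ IsUnrefinableChain z y (z :: t) := by
  obtain ⟨t, rfl⟩ := h.eq_cons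
  cases t with
  | nil => exact Or.inl ⟨(isUnrefinableChain_singleton_iff.1 h).2, rfl⟩
  | cons z t =>
    obtain ⟨-, h1, h2⟩ := isUnrefinableChain_cons_cons.1 h
    exact Or.inr ⟨z, t, rfl, h1, h2⟩

theorem IsUnrefinableChain.cons {x y z : P} {c : List P} (h : IsUnrefinableChain z y c)
    (hx : x ⋖ z) : IsUnrefinableChain x y (x :: c) := by
  obtain ⟨t, rfl⟩ := h.eq_cons
  exact isUnrefinableChain_cons_cons.2 ⟨rfl, hx, h⟩

theorem IsUnrefinableChain.eq_concat {x y : P} {c : List P} (h : IsUnrefinableChain x y c) :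
    ∃ t, c = t ++ [y] := by
  obtain ⟨-, -, h⟩ := h
  exact List.getLast?_eq_some_iff.1 h

theorem isUnrefinableChain_split {x y b : P} {p q : List P} :
    IsUnrefinableChain x y (p ++ b :: q) ↔
      IsUnrefinableChain x b (p ++ [b]) ∧ IsUnrefinableChain b y (b :: q) := by
  unfold IsUnrefinableChain
  rw [List.isChain_split]
  cases p <;> simp [List.getLast?_append, List.getLast?_cons] <;> tauto

theorem IsUnrefinableChain.pairwise_lt {x y : P} {c : List P} (h : IsUnrefinableChain x y c) :
    c.Pairwise (· < ·) :=
  List.isChain_iff_pairwise.1 (h.1.imp fun _ _ h => h.lt)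

theorem IsUnrefinableChain.mem_left {x y : P} {c : List P} (h : IsUnrefinableChain x y c) :
    x ∈ c := by
  obtain ⟨t, rfl⟩ := h.eq_cons
  simp

theorem IsUnrefinableChain.mem_right {x y : P} {c : List P} (h : IsUnrefinableChain x y c) :
    y ∈ c := by
  obtain ⟨t, rfl⟩ := h.eq_concat
  simp

theorem IsUnrefinableChain.left_le {x y v : P} {c : List P} (h : IsUnrefinableChain x y c)
    (hv : v ∈ c) : x ≤ v := by
  obtain ⟨t, rfl⟩ := h.eq_cons
  have := List.pairwise_cons.1 h.pairwise_lt
  rcases List.mem_cons.1 hv with rfl | hv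
  · exact le_rfl
  · exact (this.1 v hv).le

theorem IsUnrefinableChain.le_right {x y v : P} {c : List P} (h : IsUnrefinableChain x y c)
    (hv : v ∈ c) : v ≤ y := by
  obtain ⟨t, rfl⟩ := h.eq_concat
  have := (List.pairwise_append.1 h.pairwise_lt).2.2
  rcases List.mem_append.1 hv with hv | hv
  · exact (this v hv y (by simp)).le
  · exact (List.mem_singleton.1 hv).le

theorem IsUnrefinableChain.le {x y : P} {c : List P} (h : IsUnrefinableChain x y c) : x ≤ y :=
  h.left_le h.mem_right

theorem IsUnrefinableChain.isChain {x y : P} {c : List P} (h : IsUnrefinableChain x y c) :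
    IsChain (· ≤ ·) {v | v ∈ c} := by
  intro u hu v hv huv
  by_contra hnot
  rw [not_or] at hnot
  have : ∀ a ∈ c, ∀ b ∈ c, a ≤ b ∨ b ≤ a := by
    have h2 := h.pairwise_lt
    clear hu hv h
    induction c with
    | nil => simp
    | cons w c ih =>
      obtain ⟨h3, h4⟩ := List.pairwise_cons.1 h2
      intro a ha b hb
      rcases List.mem_cons.1 ha with ha | ha <;> rcases List.mem_cons.1 hb with hb | hb
      · exact Or.inl (ha.trans hb.symm).le
      · exact Or.inl (ha ▸ (h3 b hb).le)
      · exact Or.inr (hb ▸ (h3 a ha).le)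
      · exact ih h4 a ha b hb
  exact (this u hu v hv).elim hnot.1 hnot.2

/-- An unrefinable chain is determined by its set of elements. -/
theorem IsUnrefinableChain.ext {x y x' y' : P} {c c' : List P} (h : IsUnrefinableChain x y c)
    (h' : IsUnrefinableChain x' y' c') (hcc : ∀ v, v ∈ c ↔ v ∈ c') : c = c' := by
  have hp : c.Perm c' :=
    (List.perm_ext_iff_of_nodup (h.pairwise_lt.imp ne_of_lt)
      (h'.pairwise_lt.imp ne_of_lt)).2 hcc
  exact hp.eq_of_pairwise (fun a b _ _ h1 h2 => absurd h2 h1.asymm) h.pairwise_lt h'.pairwise_lt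

/-- In a graded poset the length of an unrefinable chain depends on its ends only. -/
theorem IsUnrefinableChain.length_eq {ρ : P → ℕ} (hρ : IsRankFunction ρ) {x y : P} {c : List P}
    (h : IsUnrefinableChain x y c) : c.length + ρ x = ρ y + 1 := by
  obtain ⟨t, rfl⟩ := h.eq_cons
  induction t generalizing x with
  | nil =>
    obtain ⟨-, rfl⟩ := isUnrefinableChain_singleton_iff.1 h
    simp [add_comm]
  | cons z t ih =>
    obtain ⟨-, h1, h2⟩ := isUnrefinableChain_cons_cons.1 h
    have := ih h2
    have := hρ.covBy _ _ h1
    simp only [List.length_cons] at *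
    omega

end ChainLists

/-! ### Label words and descents -/

section LabelWord

variable {P : Type*} {Λ : Type*}

theorem labelWord_cons_cons (lam : P → P → Λ) (a b : P) (t : List P) :
    labelWord lam (a :: b :: t) = lam a b :: labelWord lam (b :: t) := rfl

theorem labelWord_split (lam : P → P → Λ) (p : List P) (b : P) (q : List P) :
    labelWord lam (p ++ b :: q) = labelWord lam (p ++ [b]) ++ labelWord lam (b :: q) := by
  induction p with
  | nil => rfl
  | cons a p ih =>
    cases p with
    | nil => rfl
    | cons a' p => simp only [List.cons_append, labelWord_cons_cons] at ih ⊢; rw [ih]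

theorem length_labelWord (lam : P → P → Λ) (c : List P) :
    (labelWord lam c).length = c.length - 1 := by
  simp [labelWord]

theorem isRisingChain_cons_cons_cons [PartialOrder Λ] {lam : P → P → Λ} {a b d : P} {t : List P} :
    IsRisingChain lam (a :: b :: d :: t) ↔
      lam a b ≤ lam b d ∧ IsRisingChain lam (b :: d :: t) := by
  simp only [IsRisingChain, labelWord_cons_cons, List.isChain_cons_cons]

theorem IsRisingChain.tail [PartialOrder Λ] {lam : P → P → Λ} {a b : P} {t : List P}
    (h : IsRisingChain lam (a :: b :: t)) : IsRisingChain lam (b :: t) :=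
  List.IsChain.tail (l := labelWord lam (a :: b :: t)) h

/-- A chain that is not rising has a descent. -/
theorem exists_descent [PartialOrder Λ] {lam : P → P → Λ} {c : List P}
    (h : ¬ IsRisingChain lam c) :
    ∃ p a b d q, c = p ++ a :: b :: d :: q ∧ ¬ lam a b ≤ lam b d := by
  induction c with
  | nil => exact absurd List.isChain_nil h
  | cons a c ih =>
    match c, h, ih with
    | [], h, _ => exact absurd List.isChain_nil h
    | [b], h, _ => exact absurd (List.isChain_singleton _) h
    | b :: d :: q, h, ih =>
      by_cases hab : lam a b ≤ lam b d
      · obtain ⟨p, a', b', d', q', h1, h2⟩ :=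
          ih (fun h' => h (isRisingChain_cons_cons_cons.2 ⟨hab, h'⟩))
        exact ⟨a :: p, a', b', d', q', by rw [h1]; rfl, h2⟩
      · exact ⟨[], a, b, d, q, rfl, hab⟩

end LabelWord

/-! ### A criterion for EL-labelings -/

section ELCriterion

variable {P : Type*} [PartialOrder P] {Λ : Type*}

/-- A criterion for EL-labelings. To every interval `[x, y]` one attaches a set of labels
`S x y`, which shrinks when `x` grows. It suffices that the least element of `S x y` is the label
of an atom of `[x, y]`, that all other atoms have larger labels, and that `S z y` still has an
element below the label of any such other atom `z`: then no chain through `z` is rising. -/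
theorem isELLabeling_of_labelSets [WellFoundedGT P] [LinearOrder Λ] (lam : P → P → Λ)
    (S : P → P → Set Λ)
    (hmono : ∀ x y z, x ⋖ z → z ≤ y → S z y ⊆ S x y)
    (hatom : ∀ x y, x < y → ∃ z, x ⋖ z ∧ z ≤ y ∧ IsLeast (S x y) (lam x z) ∧
      ∀ z', x ⋖ z' → z' ≤ y → z' ≠ z →
        lam x z < lam x z' ∧ (z' < y → ∃ s ∈ S z' y, s < lam x z')) :
    IsELLabeling lam := by
  have key : ∀ y x : P, x ≤ y → ∃ c, (IsUnrefinableChain x y c ∧ IsRisingChain lam c) ∧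
      (∀ c', IsUnrefinableChain x y c' ∧ IsRisingChain lam c' → c' = c) ∧
      (x < y → ∃ x₁ t, c = x :: x₁ :: t ∧ IsLeast (S x y) (lam x x₁) ∧
        ∀ z, x ⋖ z → z ≤ y → z ≠ x₁ → lam x x₁ < lam x z) := by
    intro y x
    induction x using WellFoundedGT.induction with
    | ind x ih =>
    intro hxy
    rcases hxy.eq_or_lt with rfl | hlt
    · refine ⟨[x], ⟨.singleton x, List.isChain_nil⟩, ?_, fun h => absurd h (lt_irrefl x)⟩
      rintro c' ⟨hc', -⟩
      rcases hc'.cases with ⟨-, h⟩ | ⟨z, t, -, hz, hzt⟩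
      · exact h
      · exact absurd hzt.le hz.lt.not_ge
    · obtain ⟨z, hxz, hzy, hleast, hother⟩ := hatom x y hlt
      obtain ⟨c, ⟨hc, hr⟩, huniq, hfirst⟩ := ih z hxz.lt hzy
      obtain ⟨t, rfl⟩ := hc.eq_cons
      refine ⟨x :: z :: t, ⟨hc.cons hxz, ?_⟩, ?_, fun _ => ⟨z, t, rfl, hleast,
        fun z' h1 h2 h3 => (hother z' h1 h2 h3).1⟩⟩
      · rcases hzy.eq_or_lt with rfl | hzlt
        · rcases hc.cases with ⟨-, h⟩ | ⟨u, t, -, hu, hut⟩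
          · rw [h]
            exact List.isChain_singleton _
          · exact absurd hut.le hu.lt.not_ge
        · obtain ⟨x₁, t', ht, hl, -⟩ := hfirst hzlt
          rw [ht] at hr ⊢
          exact isRisingChain_cons_cons_cons.2 ⟨hleast.2 (hmono x y z hxz hzy hl.1), hr⟩
      · rintro c' ⟨hc', hr'⟩
        rcases hc'.cases with ⟨rfl, -⟩ | ⟨z', t', rfl, hz', hzt'⟩
        · exact absurd hlt (lt_irrefl x)
        by_cases hzz : z' = z
        · subst hzz
          rw [huniq _ ⟨hzt', hr'.tail⟩]
        exfalso
        -- the rising chain from `z'` to `y` begins with the least element of `S z' y`, which is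
        -- less than the label of `x ⋖ z'`
        have hz'y : z' ≠ y := by
          rintro rfl
          exact hz'.2 hxz.lt (lt_of_le_of_ne hzy (Ne.symm hzz))
        have hz'lt := lt_of_le_of_ne hzt'.le hz'y
        obtain ⟨c₂, -, huniq₂, hfirst₂⟩ := ih z' hz'.lt hzt'.le
        obtain ⟨x₁, t₂, ht₂, hl₂, -⟩ := hfirst₂ hz'lt
        obtain ⟨s, hs, hslt⟩ := (hother z' hz' hzt'.le hzz).2 hz'lt
        rw [huniq₂ _ ⟨hzt', hr'.tail⟩, ht₂] at hr'
        exact absurd ((isRisingChain_cons_cons_cons.1 hr').1.trans (hl₂.2 hs)) hslt.not_ge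
  refine ⟨fun x y hxy => ?_, fun x y x₁ t hc hr z hxz hzy hz => ?_⟩
  · obtain ⟨c, h1, h2, -⟩ := key y x hxy
    exact ⟨c, h1, h2⟩
  · obtain ⟨c, -, h2, h3⟩ := key y x hc.le
    obtain ⟨x₂, t', h4, -, h5⟩ := h3 (hxz.lt.trans_le hzy)
    rw [← h2 _ ⟨hc, hr⟩] at h4
    obtain ⟨rfl, -⟩ : x₁ = x₂ ∧ t = t' := by simpa using h4
    exact h5 z hxz hzy hz

/-- The rising chain of an interval is lexicographically first: at the first place where another
chain leaves it, the label of the rising chain is the smaller one. -/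
theorem IsELLabeling.lex_labelWord [PartialOrder Λ] {lam : P → P → Λ} (hlam : IsELLabeling lam)
    {x y : P} {c c' : List P} (hc : IsUnrefinableChain x y c) (hr : IsRisingChain lam c)
    (hc' : IsUnrefinableChain x y c') (hne : c' ≠ c) :
    List.Lex (· < ·) (labelWord lam c) (labelWord lam c') := by
  induction c generalizing x c' with
  | nil => obtain ⟨t, ht⟩ := hc.eq_cons; simp at ht
  | cons a c ih =>
    rcases hc.cases with ⟨rfl, h⟩ | ⟨z, t, h, hz, hzt⟩
    · rcases hc'.cases with ⟨-, h'⟩ | ⟨z', t', -, hz', hzt'⟩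
      · exact absurd (h'.trans h.symm) hne
      · exact absurd hzt'.le hz'.lt.not_ge
    · obtain ⟨rfl, rfl⟩ : a = x ∧ c = z :: t := by simpa using h
      rcases hc'.cases with ⟨rfl, -⟩ | ⟨z', t', rfl, hz', hzt'⟩
      · exact absurd hzt.le hz.lt.not_ge
      rw [labelWord_cons_cons, labelWord_cons_cons]
      by_cases hzz : z' = z
      · subst hzz
        exact .cons (ih hzt hr.tail hzt' (by simpa using hne))
      · exact .rel (hlam.first_label_lt _ _ _ _ hc hr z' hz' hzt'.le hzz)

end ELCriterion

/-! ### Exchanging a descent -/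

section Exchange

variable {P : Type*} [PartialOrder P] {Λ : Type*}

theorem List.Lex.append_of_length_eq {α : Type*} {r : α → α → Prop} {s t : List α}
    (h : List.Lex r s t) (hl : s.length = t.length) (s' t' : List α) :
    List.Lex r (s ++ s') (t ++ t') := by
  induction h with
  | nil => simp at hl
  | cons _ ih => exact .cons (ih (by simpa using hl))
  | rel h => exact .rel h

/-- If all descents of the maximal chain `c'` lie on the maximal chain `c`, then `c'` is not
lexicographically after `c`: the chain `c'` is rising between consecutive descents, hence
lexicographically first there. -/
theorem IsELLabeling.eq_or_lex_of_descents [PartialOrder Λ] {lam : P → P → Λ}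
    (hlam : IsELLabeling lam) {ρ : P → ℕ} (hρ : IsRankFunction ρ) {x y : P} {c c' : List P}
    (hc : IsUnrefinableChain x y c) (hc' : IsUnrefinableChain x y c')
    (hdesc : ∀ p a b d q, c' = p ++ a :: b :: d :: q → ¬ lam a b ≤ lam b d → b ∈ c) :
    c' = c ∨ List.Lex (· < ·) (labelWord lam c') (labelWord lam c) := by
  induction hm : c'.length using Nat.strong_induction_on generalizing x y c c' with
  | _ m ih =>
  by_cases hr : IsRisingChain lam c'
  · by_cases he : c = c'
    · exact Or.inl he.symm
    · exact Or.inr (hlam.lex_labelWord hc' hr hc he)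
  obtain ⟨p, a, b, d, q, rfl, hab⟩ := exists_descent hr
  obtain ⟨p₂, q₂, rfl⟩ := List.append_of_mem (hdesc p a b d q rfl hab)
  have hassoc : p ++ a :: b :: d :: q = (p ++ [a]) ++ b :: d :: q := by simp
  rw [hassoc] at hc' ⊢
  obtain ⟨h1', h2'⟩ := isUnrefinableChain_split.1 hc'
  obtain ⟨h1, h2⟩ := isUnrefinableChain_split.1 hc
  have hpw := hc.pairwise_lt
  rw [List.pairwise_append] at hpw
  have i1 := ih _ (by simp at hm ⊢; omega) h1 h1' (by
    intro p' a' b' d' q' he hn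
    have hb' : b' ≤ b := h1'.le_right (by rw [he]; simp)
    have hmem := hdesc p' a' b' d' (q' ++ d :: q) (by
      have : p ++ a :: b :: d :: q = (p ++ [a] ++ [b]) ++ d :: q := by simp
      rw [this, he]; simp) hn
    rcases List.mem_append.1 hmem with h | h
    · exact List.mem_append_left _ h
    · rcases List.mem_cons.1 h with rfl | h
      · simp
      · exact absurd ((List.pairwise_cons.1 hpw.2.1).1 _ h) hb'.not_gt) rfl
  have i2 := ih _ (by simp at hm ⊢; omega) h2 h2' (by
    intro p' a' b' d' q' he hn
    have hb' : b ≤ b' := h2'.left_le (by rw [he]; simp)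
    have hmem := hdesc (p ++ [a] ++ p') a' b' d' q' (by rw [hassoc, he]; simp) hn
    rcases List.mem_append.1 hmem with h | h
    · exact absurd (hpw.2.2 _ h b (by simp)) hb'.not_gt
    · exact h) rfl
  -- words of equal length: a strict inequality between the first parts cannot come from a prefix
  have hlen : (labelWord lam (p ++ [a] ++ [b])).length = (labelWord lam (p₂ ++ [b])).length := by
    have := h1.length_eq hρ
    have := h1'.length_eq hρ
    rw [length_labelWord, length_labelWord]
    omega
  rw [labelWord_split lam (p ++ [a]), labelWord_split lam p₂]
  rcases i1 with i1 | i1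
  · have hp := List.append_cancel_right i1
    rcases i2 with i2 | i2
    · left; rw [hp, i2]
    · right; rw [i1]; exact i2.append_left _ _
  · right; exact i1.append_of_length_eq hlen _ _

/-- At a descent `b` of a maximal chain, the part of the chain around `b` can be replaced by the
rising chain. This gives a lexicographically smaller maximal chain which differs only in `b`. -/
theorem IsELLabeling.exists_exchange [PartialOrder Λ] {lam : P → P → Λ}
    (hlam : IsELLabeling lam) {ρ : P → ℕ} (hρ : IsRankFunction ρ) {x y a b d : P} {p q : List P}
    (hc : IsUnrefinableChain x y (p ++ a :: b :: d :: q)) (hab : ¬ lam a b ≤ lam b d) :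
    ∃ c, IsUnrefinableChain x y c ∧
      List.Lex (· < ·) (labelWord lam c) (labelWord lam (p ++ a :: b :: d :: q)) ∧ b ∉ c ∧
      ∀ v ∈ p ++ a :: b :: d :: q, v ≠ b → v ∈ c := by
  have hnd := hc.pairwise_lt.imp ne_of_lt
  obtain ⟨h1, h2⟩ := isUnrefinableChain_split.1 hc
  obtain ⟨-, hcab, h3⟩ := isUnrefinableChain_cons_cons.1 h2
  obtain ⟨-, hcbd, h4⟩ := isUnrefinableChain_cons_cons.1 h3
  obtain ⟨e, ⟨he, her⟩, -⟩ := hlam.existsUnique_rising a d (hcab.le.trans hcbd.le)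
  have hrank : ρ d = ρ a + 2 := by rw [hρ.covBy _ _ hcbd, hρ.covBy _ _ hcab]
  have hlen := he.length_eq hρ
  have : ∃ b', e = [a, b', d] ∧ a ⋖ b' ∧ b' ⋖ d := by
    rcases he.cases with ⟨rfl, -⟩ | ⟨b', t, rfl, h5, h6⟩
    · omega
    rcases h6.cases with ⟨rfl, ht⟩ | ⟨d', t', ht, h7, h8⟩
    · exact absurd hcbd.lt (h5.2 hcab.lt)
    · rw [ht] at hlen ⊢
      obtain rfl : t' = [] := List.eq_nil_of_length_eq_zero (by simp at hlen; omega)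
      obtain ⟨-, rfl⟩ := isUnrefinableChain_singleton_iff.1 h8
      exact ⟨b', rfl, h5, h7⟩
  obtain ⟨b', rfl, hcab', hcbd'⟩ := this
  have hbb : b ≠ b' := by
    rintro rfl
    exact hab (isRisingChain_cons_cons_cons.1 her).1
  refine ⟨p ++ a :: b' :: d :: q, isUnrefinableChain_split.2 ⟨h1, (h4.cons hcbd').cons hcab'⟩,
    ?_, ?_, ?_⟩
  · rw [labelWord_split lam p, labelWord_split lam p a (b :: d :: q)]
    exact List.Lex.append_left _
      (.rel (hlam.first_label_lt _ _ _ _ he her b hcab hcbd.le hbb)) _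
  · simp only [List.pairwise_append, List.pairwise_cons, List.mem_cons] at hnd
    simp only [List.mem_append, List.mem_cons]
    rintro (h | h | h | h | h)
    · exact hnd.2.2 b h b (by simp) rfl
    · exact hcab.ne h.symm
    · exact hbb h
    · exact hcbd.ne h
    · exact hnd.2.1.2.1 b (Or.inr h) rfl
  · simp only [List.mem_append, List.mem_cons]
    tauto

end Exchange

/-! ### Lexicographic shellings -/

section Shelling

variable {P : Type*} [PartialOrder P] {Λ : Type*}

theorem finite_setOf_isUnrefinableChain [Finite P] (x y : P) :
    {c : List P | IsUnrefinableChain x y c}.Finite := by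
  refine Set.Finite.of_finite_image (f := fun c => {v | v ∈ c}) (Set.toFinite _) ?_
  intro c hc c' hc' h
  exact hc.ext hc' fun v => Set.ext_iff.1 h v

/-- In a poset with an EL-labeling, the maximal chains of every interval, listed lexicographically,
form a shelling. -/
theorem IsELLabeling.exists_shelling [Finite P] [LinearOrder Λ] {lam : P → P → Λ}
    (hlam : IsELLabeling lam) {ρ : P → ℕ} (hρ : IsRankFunction ρ) (x y : P) :
    ∃ (t : ℕ) (L : Fin t → List P), Function.Injective L ∧
      (∀ c, IsUnrefinableChain x y c ↔ c ∈ Set.range L) ∧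
      ∀ i j, i < j → ∃ l, l < j ∧ ∃ v ∈ L j, v ∉ L i ∧ v ∉ L l ∧ ∀ w ∈ L j, w ≠ v → w ∈ L l := by
  have hfin := finite_setOf_isUnrefinableChain x y
  obtain ⟨t, ⟨e₀⟩⟩ := @Finite.exists_equiv_fin _ hfin.to_subtype
  let f : Fin t → List Λ := fun i => labelWord lam (e₀.symm i).1
  let L : Fin t → List P := fun i => (e₀.symm (Tuple.sort f i)).1
  have hmono : Monotone fun i => labelWord lam (L i) := Tuple.monotone_sort f
  have hL : ∀ i, IsUnrefinableChain x y (L i) := fun i => (e₀.symm (Tuple.sort f i)).2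
  have hrange : ∀ c, IsUnrefinableChain x y c → ∃ i, L i = c := fun c hc =>
    ⟨(Tuple.sort f).symm (e₀ ⟨c, hc⟩), by simp [L]⟩
  have hinj : Function.Injective L := fun i j h => by
    simpa [L, Subtype.ext_iff.symm] using h
  refine ⟨t, L, hinj, fun c => ⟨fun h => hrange c h, ?_⟩, fun i j hij => ?_⟩
  · rintro ⟨i, rfl⟩
    exact hL i
  · have hnl : ¬ (L j = L i ∨ List.Lex (· < ·) (labelWord lam (L j)) (labelWord lam (L i))) := by
      rintro (h | h)
      · exact hij.ne' (hinj h)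
      · exact (hmono hij.le).not_gt h
    have := mt (hlam.eq_or_lex_of_descents hρ (hL i) (hL j)) hnl
    push Not at this
    obtain ⟨p, a, b, d, q, hj, hab, hbi⟩ := this
    have hLj := hL j
    rw [hj] at hLj
    obtain ⟨c, hc, hlex, hbc, hsub⟩ := hlam.exists_exchange hρ hLj (not_le_of_gt hab)
    obtain ⟨l, rfl⟩ := hrange c hc
    refine ⟨l, ?_, b, by rw [hj]; simp, hbi, hbc, by rwa [hj]⟩
    by_contra hle
    rw [← hj] at hlex
    exact (hmono (not_lt.1 hle)).not_gt hlex

/-- In a finite poset, every chain of the interval `[x, y]` extends to a maximal chain. -/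
theorem exists_isUnrefinableChain_of_isChain [Finite P] {x y : P} (hxy : x ≤ y) {S : Set P}
    (hS : IsChain (· ≤ ·) S) (hsub : S ⊆ Set.Icc x y) :
    ∃ c, IsUnrefinableChain x y c ∧ ∀ v ∈ S, v ∈ c := by
  induction x using WellFoundedGT.induction generalizing S with
  | ind x ih =>
  rcases hxy.eq_or_lt with rfl | hlt
  · exact ⟨[x], .singleton x, fun v hv => by simpa using le_antisymm (hsub hv).2 (hsub hv).1⟩
  have hT : (insert y (S \ {x})).Nonempty := ⟨y, Set.mem_insert _ _⟩
  obtain ⟨u, hu⟩ := (Set.toFinite _).exists_minimal hT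
  have huy : u ≤ y := by
    rcases hu.1 with rfl | h
    · exact le_rfl
    · exact (hsub h.1).2
  have hux : x < u := by
    rcases hu.1 with rfl | h
    · exact hlt
    · exact lt_of_le_of_ne (hsub h.1).1 (Ne.symm h.2)
  have hle : ∀ v ∈ S \ {x}, u ≤ v := by
    intro v hv
    rcases hu.1 with h | h
    · have := hu.2 (Set.mem_insert_of_mem _ hv) (h ▸ (hsub hv.1).2)
      exact this
    · rcases hS.total h.1 hv.1 with h' | h'
      · exact h'
      · exact hu.2 (Set.mem_insert_of_mem _ hv) h'
  obtain ⟨z, hxz, hzu⟩ := exists_covBy_le_of_lt hux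
  obtain ⟨c, hc, hcS⟩ := ih z hxz.lt (hzu.trans huy) (hS.mono Set.sdiff_subset)
    fun v hv => ⟨hzu.trans (hle v hv), (hsub hv.1).2⟩
  refine ⟨x :: c, hc.cons hxz, fun v hv => ?_⟩
  by_cases hvx : v = x
  · simp [hvx]
  · exact List.mem_cons_of_mem _ (hcS v ⟨hv, hvx⟩)

theorem IsUnrefinableChain.ncard {ρ : P → ℕ} (hρ : IsRankFunction ρ) {x y : P} {c : List P}
    (hc : IsUnrefinableChain x y c) : {v | v ∈ c}.ncard = ρ y + 1 - ρ x := by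
  classical
  have h1 := hc.length_eq hρ
  have h2 : {v | v ∈ c} = ((c.toFinset : Finset P) : Set P) := by ext; simp
  rw [h2, Set.ncard_coe_finset,
    List.toFinset_card_of_nodup (hc.pairwise_lt.imp ne_of_lt : c.Nodup)]
  omega

/-- A finite bounded graded poset with an EL-labeling is shellable. -/
theorem IsELLabeling.isShellablePoset [Finite P] [LinearOrder Λ] {lam : P → P → Λ}
    (hlam : IsELLabeling lam) {ρ : P → ℕ} (hρ : IsRankFunction ρ) {x y : P} (hx : IsBot x)
    (hy : IsTop y) : IsShellablePoset P := by
  obtain ⟨t, L, hinj, hL, hsh⟩ := hlam.exists_shelling hρ x y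
  have hU : ∀ i, IsUnrefinableChain x y (L i) := fun i => (hL _).2 ⟨i, rfl⟩
  have hcover : ∀ S : Set P, IsChain (· ≤ ·) S → ∃ i, S ⊆ {v | v ∈ L i} := by
    intro S hS
    obtain ⟨c, hc, hsub⟩ := exists_isUnrefinableChain_of_isChain (hx y) hS
      fun v _ => ⟨hx v, hy v⟩
    obtain ⟨i, rfl⟩ := (hL c).1 hc
    exact ⟨i, hsub⟩
  refine ⟨t, fun i => {v | v ∈ L i}, fun i j h => hinj ((hU i).ext (hU j) (Set.ext_iff.1 h)),
    fun S => ⟨fun hS => ?_, ?_⟩, ⟨ρ y + 1 - ρ x, fun i => ⟨Set.toFinite _, (hU i).ncard hρ⟩⟩, ?_⟩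
  · obtain ⟨i, hi⟩ := hcover S hS.1
    exact ⟨i, (hS.2 (hU i).isChain hi).symm⟩
  · rintro ⟨i, rfl⟩
    refine ⟨(hU i).isChain, fun S hS hsub => ?_⟩
    obtain ⟨j, hj⟩ := hcover S hS
    have hij : {v | v ∈ L i} = {v | v ∈ L j} := Set.eq_of_subset_of_ncard_le (hsub.trans hj)
      (by rw [(hU i).ncard hρ, (hU j).ncard hρ]) (Set.toFinite _)
    exact hsub.antisymm (hj.trans hij.symm.subset)
  · intro i j hij
    obtain ⟨l, hl, v, hv, hvi, hvl, hw⟩ := hsh i j hij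
    have : {v | v ∈ L l} ∩ {v | v ∈ L j} = {v | v ∈ L j} \ {v} := by
      ext w
      constructor
      · rintro ⟨h1, h2⟩
        exact ⟨h2, fun h => hvl (h ▸ h1)⟩
      · rintro ⟨h1, h2⟩
        exact ⟨hw w h1 h2, h1⟩
    refine ⟨l, hl, v, hv, ?_, this⟩
    rw [this]
    rintro w ⟨h1, h2⟩
    exact ⟨h2, fun h => hvi (h ▸ h1)⟩

end Shelling

/-! ### Homology of shelled order complexes -/

section ShellingHomology

variable {Q : Type*} [PartialOrder Q]

theorem range_face {m : ℕ} (e : Fin (m + 1) ↪o Q) (p : Fin (m + 1)) :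
    Set.range ((Fin.succAboveOrderEmb p).trans e) = Set.range e \ {e p} := by
  ext w
  constructor
  · rintro ⟨i, rfl⟩
    refine ⟨⟨_, rfl⟩, fun h => ?_⟩
    exact Fin.succAbove_ne p i (e.injective h)
  · rintro ⟨⟨i, rfl⟩, hi⟩
    obtain ⟨j, hj⟩ := Fin.exists_succAbove_eq (fun h => hi (by rw [h]; rfl) : i ≠ p)
    exact ⟨j, by simp [hj]⟩

/-- A finite chain can be enlarged by a vertex comparable to all its elements; the chain is then
the face of the enlarged chain opposite to that vertex. -/
theorem exists_insert_orderEmbedding {m : ℕ} (c : Fin m ↪o Q) {v : Q} (hv : v ∉ Set.range c)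
    (hchain : IsChain (· ≤ ·) (insert v (Set.range c))) :
    ∃ (e : Fin (m + 1) ↪o Q) (p : Fin (m + 1)), e p = v ∧ (Fin.succAboveOrderEmb p).trans e = c := by
  classical
  let : LinearOrder ↥(insert v (Set.range c)) := hchain.linearOrder
  let : Fintype ↥(insert v (Set.range c)) := Fintype.ofFinite _
  have hcard : Fintype.card ↥(insert v (Set.range c)) = m + 1 := by
    rw [← Nat.card_eq_fintype_card, Nat.card_coe_set_eq, Set.ncard_insert_of_notMem hv,
      ← Nat.card_coe_set_eq, Nat.card_range_of_injective c.injective, Nat.card_fin]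
  let o : Fin (m + 1) ≃o ↥(insert v (Set.range c)) := monoEquivOfFin _ hcard
  let e : Fin (m + 1) ↪o Q := o.toOrderEmbedding.trans (OrderEmbedding.subtype _)
  have hrange : Set.range e = insert v (Set.range c) := by
    ext w
    constructor
    · rintro ⟨i, rfl⟩
      exact (o i).2
    · intro hw
      exact ⟨o.symm ⟨w, hw⟩, by simp [e]⟩
  obtain ⟨p, hp⟩ : v ∈ Set.range e := by rw [hrange]; exact Set.mem_insert _ _
  refine ⟨e, p, hp, ?_⟩
  rw [← OrderEmbedding.range_inj]
  rw [range_face, hrange, hp]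
  simp [hv]

variable (R : Type*) [CommRing R]

theorem orderBoundary_single {m : ℕ} (e : Fin (m + 1) ↪o Q) (r : R) :
    orderBoundary R Q m (Finsupp.single e r) = ∑ j : Fin (m + 1),
      Finsupp.single ((Fin.succAboveOrderEmb j).trans e) (r * (-1 : R) ^ (j : ℕ)) := by
  rw [orderBoundary, Finsupp.linearCombination_single, Finset.smul_sum]
  simp

theorem orderBoundary_comp_orderBoundary (m : ℕ) (w : OrderChains R Q (m + 2)) :
    orderBoundary R Q m (orderBoundary R Q (m + 1) w) = 0 := by
  induction w using Finsupp.induction_linear with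
  | zero => simp
  | add f g hf hg => rw [map_add, map_add, hf, hg, add_zero]
  | single e r =>
    simp only [orderBoundary_single, map_sum]
    rw [← Fintype.sum_prod_type']
    -- the two ways to remove a pair of vertices cancel
    refine Finset.sum_involution
      (fun (x : Fin (m + 2) × Fin (m + 1)) _ => (x.1.succAbove x.2, x.2.predAbove x.1)) ?_ ?_ ?_ ?_
    · rintro ⟨i, j⟩ -
      have hface : (Fin.succAboveOrderEmb (j.predAbove i)).trans
          ((Fin.succAboveOrderEmb (i.succAbove j)).trans e) =
          (Fin.succAboveOrderEmb j).trans ((Fin.succAboveOrderEmb i).trans e) := by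
        ext k
        simp [Fin.succAbove_succAbove_succAbove_predAbove]
      dsimp only
      rw [hface, ← Finsupp.single_add, mul_assoc, mul_assoc, ← pow_add, ← pow_add,
        Fin.neg_one_pow_succAbove_add_predAbove]
      simp
    · rintro ⟨i, j⟩ - -
      simp [Fin.succAbove_ne]
    · simp
    · rintro ⟨i, j⟩ -
      simp [Fin.succAbove_succAbove_predAbove, Fin.predAbove_predAbove_succAbove]

/-- If some face of the simplex `e` is a face of no other simplex of the cycle `z`, then `e` does
not occur in `z`. -/
theorem apply_eq_zero_of_unique_coface {m : ℕ} {z : OrderChains R Q (m + 1)}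
    (hz : orderBoundary R Q m z = 0) (e : Fin (m + 1) ↪o Q) (p : Fin (m + 1))
    (huniq : ∀ e' ∈ z.support, ∀ p' : Fin (m + 1),
      (Fin.succAboveOrderEmb p').trans e' = (Fin.succAboveOrderEmb p).trans e → e' = e ∧ p' = p) :
    z e = 0 := by
  classical
  have h := DFunLike.congr_fun hz ((Fin.succAboveOrderEmb p).trans e)
  rw [← Finsupp.sum_single z, Finsupp.sum, map_sum, Finsupp.finsetSum_apply] at h
  simp only [orderBoundary_single, Finsupp.finsetSum_apply, Finsupp.single_apply] at h
  by_contra hne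
  rw [Finset.sum_eq_single e, Finset.sum_eq_single p] at h
  · rw [if_pos rfl] at h
    have h2 : z e * (-1) ^ (p : ℕ) * (-1) ^ (p : ℕ) = 0 := by rw [h]; simp
    rw [mul_assoc, ← mul_pow] at h2
    simp at h2
    exact hne h2
  · intro p' _ hp'
    rw [if_neg]
    exact fun h' => hp' (huniq e (by simpa using hne) p' h').2
  · simp
  · intro e' he' hee
    refine Finset.sum_eq_zero fun p' _ => if_neg fun h' => hee (huniq e' he' p' h').1
  · intro h'
    exact absurd (by simpa using h') hne

theorem sub_orderBoundary_mem_orderCycles {m : ℕ} {z : OrderChains R Q m}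
    (hz : z ∈ orderCycles R Q m) (w : OrderChains R Q (m + 1)) :
    z - orderBoundary R Q m w ∈ orderCycles R Q m := by
  cases m with
  | zero => exact Submodule.mem_top
  | succ m =>
    simp only [orderCycles, LinearMap.mem_ker] at hz ⊢
    rw [map_sub, hz, orderBoundary_comp_orderBoundary, sub_zero]

/-- Gluing a simplex `G` onto a complex `D` along a cone: if the faces of `G` lying in `D` form a
cone with apex `v`, then the faces of `G` outside `D` come in pairs `S`, `S ∪ {v}`, and every cycle
on `D ∪ 2^G` is homologous to a cycle on `D`. -/
theorem exists_sub_orderBoundary_supported {m : ℕ} (D : Set Q → Prop)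
    (hD : ∀ S T, S ⊆ T → D T → D S) {G : Set Q} (hG : IsChain (· ≤ ·) G) {v : Q} (hv : v ∈ G)
    (hcone : ∀ S, S ⊆ G → D (S \ {v}) → D S) {z : OrderChains R Q m}
    (hz : z ∈ orderCycles R Q m) (hsupp : ∀ c ∈ z.support, D (Set.range c) ∨ Set.range c ⊆ G) :
    ∃ w, ∀ c ∈ (z - orderBoundary R Q m w).support, D (Set.range c) := by
  classical
  let T : Set (Fin m ↪o Q) := {c | D (Set.range c) ∨ (Set.range c ⊆ G ∧ v ∈ Set.range c)}
  have hmem : z ∈ Finsupp.supported R R T ⊔ LinearMap.range (orderBoundary R Q m) := by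
    rw [← Finsupp.sum_single z]
    refine Submodule.sum_mem _ fun c hc => ?_
    by_cases hcT : c ∈ T
    · exact Submodule.mem_sup_left (Finsupp.single_mem_supported R _ hcT)
    have hcD : ¬ D (Set.range c) := fun h => hcT (Or.inl h)
    have hcG : Set.range c ⊆ G := (hsupp c hc).resolve_left hcD
    have hvc : v ∉ Set.range c := fun h => hcT (Or.inr ⟨hcG, h⟩)
    have hins : insert v (Set.range c) ⊆ G := Set.insert_subset hv hcG
    obtain ⟨e, p, hep, hface⟩ := exists_insert_orderEmbedding c hvc (hG.mono hins)
    have hrange : Set.range e ⊆ G := by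
      intro u hu
      by_cases hup : u = v
      · exact hup ▸ hv
      · apply hcG
        rw [← hface, range_face, hep]
        exact ⟨hu, hup⟩
    have hb := orderBoundary_single R e (z c * (-1) ^ (p : ℕ))
    rw [← Finset.add_sum_erase _ _ (Finset.mem_univ p), hface, mul_assoc, ← mul_pow] at hb
    simp only [mul_neg, mul_one, neg_neg, one_pow] at hb
    rw [eq_sub_of_add_eq hb.symm]
    refine Submodule.sub_mem _ (Submodule.mem_sup_right ⟨_, rfl⟩)
      (Submodule.mem_sup_left (Submodule.sum_mem _ fun j hj => ?_))
    refine Finsupp.single_mem_supported R _ (Or.inr ?_)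
    rw [range_face]
    refine ⟨Set.sdiff_subset.trans hrange, ⟨p, hep⟩, fun h => ?_⟩
    exact (Finset.mem_erase.1 hj).1 (e.injective (h.symm.trans hep.symm))
  obtain ⟨z', hz', _, ⟨w, rfl⟩, hsum⟩ := Submodule.mem_sup.1 hmem
  refine ⟨w, ?_⟩
  have hcyc := sub_orderBoundary_mem_orderCycles R hz w
  rw [← hsum, add_sub_cancel_right] at hcyc ⊢
  intro c hc
  rcases (Finsupp.mem_supported R z').1 hz' hc with h | ⟨hcG, hvc⟩
  · exact h
  by_contra hcD
  cases m with
  | zero => obtain ⟨i, -⟩ := hvc; exact i.elim0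
  | succ m =>
    obtain ⟨p, rfl⟩ := hvc
    refine Finsupp.mem_support_iff.1 hc (apply_eq_zero_of_unique_coface R hcyc c p ?_)
    intro e' he' p' hface
    have hr : Set.range e' \ {e' p'} = Set.range c \ {c p} := by
      rw [← range_face, ← range_face, hface]
    rcases (Finsupp.mem_supported R z').1 hz' he' with h | ⟨-, hve⟩
    · exact absurd (hcone _ hcG (hD _ _ (hr ▸ Set.sdiff_subset) h)) hcD
    have hep : e' p' = c p := by
      by_contra hne
      have : c p ∈ Set.range c \ {c p} := hr ▸ ⟨hve, fun h => hne h.symm⟩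
      exact this.2 rfl
    have hee : e' = c := by
      rw [← OrderEmbedding.range_inj, ← Set.insert_sdiff_self_of_mem (Set.mem_range_self p'), hr,
        hep, Set.insert_sdiff_self_of_mem (Set.mem_range_self p)]
    subst hee
    exact ⟨rfl, e'.injective hep⟩

/-- A shelling with facets of `d` elements kills the reduced homology below the top degree. One
removes the facets in reverse order: either the new faces of the facet can be paired off, or the
only new face is the facet itself, which is too large to occur in the cycle. -/
theorem orderCycles_le_range_of_shelling {t d m : ℕ} (F : Fin t → Set Q)
    (hchain : ∀ i, IsChain (· ≤ ·) (F i)) (hcard : ∀ i, (F i).ncard = d)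
    (hcover : ∀ c : Fin m ↪o Q, ∃ i, Set.range c ⊆ F i)
    (hshell : ∀ i j, i < j → ∃ l, l < j ∧ ∃ v ∈ F j, v ∉ F i ∧ F j \ {v} ⊆ F l) (hm : m < d) :
    orderCycles R Q m ≤ LinearMap.range (orderBoundary R Q m) := by
  have key : ∀ j, j ≤ t → ∀ z ∈ orderCycles R Q m,
      (∀ c ∈ z.support, ∃ i : Fin t, i.val < j ∧ Set.range c ⊆ F i) →
      z ∈ LinearMap.range (orderBoundary R Q m) := by
    intro j
    induction j with
    | zero =>
      intro _ z _ hsupp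
      have : z = 0 := by
        by_contra hne
        obtain ⟨c, hc⟩ := Finsupp.support_nonempty_iff.2 hne
        obtain ⟨i, hi, -⟩ := hsupp c hc
        exact absurd hi (Nat.not_lt_zero _)
      rw [this]
      exact Submodule.zero_mem _
    | succ j ih =>
      intro hj z hz hsupp
      let j' : Fin t := ⟨j, hj⟩
      have hsupp' : ∀ c ∈ z.support,
          (∃ i : Fin t, i.val < j ∧ Set.range c ⊆ F i) ∨ Set.range c ⊆ F j' := by
        intro c hc
        obtain ⟨i, hi, hci⟩ := hsupp c hc
        rcases Nat.lt_succ_iff_lt_or_eq.1 hi with h | h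
        · exact Or.inl ⟨i, h, hci⟩
        · have : i = j' := Fin.ext h
          exact Or.inr (this ▸ hci)
      by_cases hall : ∀ v ∈ F j', ∃ l, l < j' ∧ F j' \ {v} ⊆ F l
      · refine ih (Nat.le_of_succ_le hj) z hz fun c hc => ?_
        rcases hsupp' c hc with h | h
        · exact h
        have hlt : (Set.range c).ncard < (F j').ncard := by
          rw [hcard, ← Nat.card_coe_set_eq, Nat.card_range_of_injective c.injective, Nat.card_fin]
          exact hm
        obtain ⟨v, hv, hvc⟩ := Set.exists_mem_notMem_of_ncard_lt_ncard hlt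
        obtain ⟨l, hl, hsub⟩ := hall v hv
        exact ⟨l, hl, fun u hu => hsub ⟨h hu, fun huv => hvc (huv ▸ hu)⟩⟩
      · push Not at hall
        obtain ⟨v, hv, hvl⟩ := hall
        obtain ⟨w, hw⟩ := exists_sub_orderBoundary_supported R
          (fun S => ∃ i : Fin t, i.val < j ∧ S ⊆ F i)
          (fun S T hST ⟨i, hi, hT⟩ => ⟨i, hi, hST.trans hT⟩) (hchain j') hv (by
            rintro S hS ⟨i, hi, hSi⟩
            obtain ⟨l, hl, u, hu, hui, hul⟩ := hshell i j' hi
            refine ⟨l, hl, fun s hs => hul ⟨hS hs, ?_⟩⟩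
            rintro rfl
            by_cases hsv : s = v
            · exact hvl l hl (hsv ▸ hul)
            · exact hui (hSi ⟨hs, hsv⟩)) hz hsupp'
        have := ih (Nat.le_of_succ_le hj) _ (sub_orderBoundary_mem_orderCycles R hz w) hw
        simpa using Submodule.add_mem _ this (LinearMap.mem_range_self (orderBoundary R Q m) w)
  intro z hz
  refine key t le_rfl z hz fun c _ => ?_
  obtain ⟨i, hi⟩ := hcover c
  exact ⟨i, i.2, hi⟩

end ShellingHomology

/-! ### Cohen-Macaulayness -/

section CohenMacaulay

variable {P : Type*} [PartialOrder P] {Λ : Type*}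

/-- A finite graded poset with an EL-labeling is Cohen-Macaulay over every ring. -/
theorem IsELLabeling.isCohenMacaulayPoset [Finite P] [LinearOrder Λ] {lam : P → P → Λ}
    (hlam : IsELLabeling lam) {ρ : P → ℕ} (hρ : IsRankFunction ρ) (R : Type*) [CommRing R] :
    IsCohenMacaulayPoset R ρ := by
  intro x y hxy m hm
  obtain ⟨t, L, -, hL, hsh⟩ := hlam.exists_shelling hρ x y
  have hU : ∀ i, IsUnrefinableChain x y (L i) := fun i => (hL _).2 ⟨i, rfl⟩
  let F : Fin t → Set (Set.Ioo x y) := fun i => {v | v.1 ∈ L i}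
  have hcard : ∀ i, (F i).ncard = ρ y + 1 - ρ x - 2 := by
    intro i
    have h1 : (F i).ncard = (Subtype.val '' F i).ncard :=
      (Set.ncard_image_of_injective _ Subtype.val_injective).symm
    have h2 : Subtype.val '' F i = ({v | v ∈ L i} \ {x}) \ {y} := by
      ext v
      constructor
      · rintro ⟨⟨v, hv⟩, hvi, rfl⟩
        exact ⟨⟨hvi, hv.1.ne'⟩, hv.2.ne⟩
      · rintro ⟨⟨hv, hvx⟩, hvy⟩
        exact ⟨⟨v, lt_of_le_of_ne ((hU i).left_le hv) (Ne.symm hvx),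
          lt_of_le_of_ne ((hU i).le_right hv) hvy⟩, hv, rfl⟩
    rw [h1, h2, Set.ncard_sdiff_singleton_of_mem, Set.ncard_sdiff_singleton_of_mem,
      (hU i).ncard hρ, Nat.sub_sub]
    · exact (hU i).mem_left
    · exact ⟨(hU i).mem_right, hxy.ne'⟩
  have hcover : ∀ (m : ℕ) (c : Fin m ↪o Set.Ioo x y), ∃ i, Set.range c ⊆ F i := by
    intro m c
    obtain ⟨l, hl, hsub⟩ := exists_isUnrefinableChain_of_isChain hxy.le
      (S := Set.range fun i => (c i).1) (by
        rintro _ ⟨i, rfl⟩ _ ⟨j, rfl⟩ -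
        exact (le_total i j).imp (fun h => c.monotone h) (fun h => c.monotone h)) (by
        rintro _ ⟨i, rfl⟩
        exact ⟨(c i).2.1.le, (c i).2.2.le⟩)
    obtain ⟨i, rfl⟩ := (hL l).1 hl
    refine ⟨i, ?_⟩
    rintro _ ⟨j, rfl⟩
    exact hsub _ ⟨j, rfl⟩
  have hd : ρ x + 1 ≤ ρ y := by
    obtain ⟨c, hc, -⟩ := exists_isUnrefinableChain_of_isChain hxy.le
      (IsChain.empty : IsChain (· ≤ ·) (∅ : Set P)) (Set.empty_subset _)
    have h1 := hc.length_eq hρ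
    rcases hc.cases with ⟨rfl, -⟩ | ⟨z, s, rfl, -, -⟩
    · exact absurd hxy (lt_irrefl _)
    · simp only [List.length_cons] at h1
      omega
  rcases lt_or_gt_of_ne (show m ≠ ρ y + 1 - ρ x - 2 by omega) with hlt | hgt
  · refine Submodule.Quotient.subsingleton_iff.2 (Submodule.submoduleOf_eq_top.2 ?_)
    refine orderCycles_le_range_of_shelling R F (fun i u hu v hv huv => ?_) hcard (hcover m)
      (fun i j hij => ?_) hlt
    · exact (hU i).isChain hu hv (fun h => huv (Subtype.ext h))
    · obtain ⟨l, hl, v, hv, hvi, -, hw⟩ := hsh i j hij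
      have hvx : v ≠ x := by
        rintro rfl
        exact hvi (hU i).mem_left
      have hvy : v ≠ y := by
        rintro rfl
        exact hvi (hU i).mem_right
      refine ⟨l, hl, ⟨v, lt_of_le_of_ne ((hU j).left_le hv) hvx.symm,
        lt_of_le_of_ne ((hU j).le_right hv) hvy⟩, hv, hvi, ?_⟩
      rintro u ⟨hu, huv⟩
      exact hw u.1 hu fun h => huv (Subtype.ext h)
  · -- there are no chains with more than `ρ y - ρ x - 1` elements
    have : IsEmpty (Fin m ↪o Set.Ioo x y) := by
      refine ⟨fun c => ?_⟩
      obtain ⟨i, hi⟩ := hcover m c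
      have h1 := Set.ncard_le_ncard hi (Set.toFinite _)
      rw [hcard, ← Nat.card_coe_set_eq, Nat.card_range_of_injective c.injective,
        Nat.card_fin] at h1
      omega
    have : Subsingleton (OrderChains R (Set.Ioo x y) m) := inferInstance
    exact Quotient.instSubsingletonQuotient _

end CohenMacaulay

/-! ### Block minima of partitions -/

section BlockMinima

variable {n : ℕ}

/-- `b` is the least element of its block. -/
def IsBlockMin (s : Setoid (Fin n)) (b : Fin n) : Prop := ∀ c, s c b → b ≤ c

theorem IsBlockMin.of_le {s t : Setoid (Fin n)} (h : s ≤ t) {b : Fin n} (hb : IsBlockMin t b) :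
    IsBlockMin s b := fun c hc => hb c (h hc)

theorem IsBlockMin.eq {s : Setoid (Fin n)} {a b : Fin n} (ha : IsBlockMin s a)
    (hb : IsBlockMin s b) (hab : s a b) : a = b :=
  le_antisymm (ha b (s.symm' hab)) (hb a hab)

theorem not_isBlockMin {s : Setoid (Fin n)} {a b : Fin n} (hab : s a b) (hlt : a < b) :
    ¬ IsBlockMin s b := fun h => (h a hab).not_gt hlt

theorem exists_isBlockMin (s : Setoid (Fin n)) (b : Fin n) :
    ∃ a, s a b ∧ IsBlockMin s a ∧ a ≤ b := by
  obtain ⟨a, ha, hmin⟩ := WellFounded.has_min (wellFounded_lt (α := Fin n)) {a | s a b}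
    ⟨b, s.refl' b⟩
  exact ⟨a, ha, fun c hc => not_lt.1 (hmin c (s.trans' hc ha)), not_lt.1 (hmin b (s.refl' b))⟩

theorem card_quotient_eq_ncard (s : Setoid (Fin n)) :
    Nat.card (Quotient s) = {b | IsBlockMin s b}.ncard := by
  rw [← Nat.card_coe_set_eq]
  symm
  refine Nat.card_eq_of_bijective (fun b : {b | IsBlockMin s b} => (⟦b.1⟧ : Quotient s)) ⟨?_, ?_⟩
  · intro a b hab
    exact Subtype.ext (a.2.eq b.2 (Quotient.exact hab))
  · intro q
    induction q using Quotient.inductionOn with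
    | h b =>
      obtain ⟨a, hab, ha, -⟩ := exists_isBlockMin s b
      exact ⟨⟨a, ha⟩, Quotient.sound hab⟩

theorem le_mergeBlocks (s : Setoid (Fin n)) (a b : Fin n) : s ≤ mergeBlocks s a b :=
  fun _ _ h => Or.inl h

theorem mergeBlocks_rel (s : Setoid (Fin n)) (a b : Fin n) : mergeBlocks s a b a b :=
  Or.inr (Or.inl ⟨s.refl' a, s.refl' b⟩)

theorem mergeBlocks_le_iff {s t : Setoid (Fin n)} {a b : Fin n} :
    mergeBlocks s a b ≤ t ↔ s ≤ t ∧ t a b := by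
  constructor
  · exact fun h => ⟨(le_mergeBlocks s a b).trans h, h (mergeBlocks_rel s a b)⟩
  · rintro ⟨h, hab⟩ u v (huv | ⟨h1, h2⟩ | ⟨h1, h2⟩)
    · exact h huv
    · exact t.trans' (h h1) (t.trans' hab (t.symm' (h h2)))
    · exact t.trans' (h h1) (t.trans' (t.symm' hab) (t.symm' (h h2)))

theorem mergeBlocks_comm (s : Setoid (Fin n)) (a b c d : Fin n) :
    mergeBlocks (mergeBlocks s a b) c d = mergeBlocks (mergeBlocks s c d) a b := by
  have key : ∀ a b c d, mergeBlocks (mergeBlocks s a b) c d ≤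
      mergeBlocks (mergeBlocks s c d) a b := by
    intro a b c d
    refine mergeBlocks_le_iff.2 ⟨mergeBlocks_le_iff.2 ⟨?_, mergeBlocks_rel _ a b⟩, ?_⟩
    · exact (le_mergeBlocks s c d).trans (le_mergeBlocks _ a b)
    · exact le_mergeBlocks _ a b (mergeBlocks_rel s c d)
  exact le_antisymm (key a b c d) (key c d a b)

theorem mergeBlocks_congr_left {s : Setoid (Fin n)} {a a' : Fin n} (h : s a a') (b : Fin n) :
    mergeBlocks s a b = mergeBlocks s a' b := by
  have key : ∀ a a', s a a' → mergeBlocks s a b ≤ mergeBlocks s a' b := fun a a' h =>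
    mergeBlocks_le_iff.2 ⟨le_mergeBlocks _ _ _,
      (mergeBlocks s a' b).trans' (le_mergeBlocks s a' b h) (mergeBlocks_rel s a' b)⟩
  exact le_antisymm (key a a' h) (key a' a (s.symm' h))

theorem isBlockMin_mergeBlocks_iff {s : Setoid (Fin n)} {a b : Fin n} (hab : a < b)
    (hb : IsBlockMin s b) {c : Fin n} :
    IsBlockMin (mergeBlocks s a b) c ↔ IsBlockMin s c ∧ c ≠ b := by
  constructor
  · refine fun h => ⟨h.of_le (le_mergeBlocks s a b), ?_⟩
    rintro rfl
    exact not_isBlockMin (mergeBlocks_rel s a c) hab h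
  · rintro ⟨hc, hcb⟩ d (h | ⟨-, h⟩ | ⟨h1, h2⟩)
    · exact hc d h
    · exact absurd (hc.eq hb h) hcb
    · exact (hc a (s.symm' h2)).trans (hab.le.trans (hb d h1))

/-- The partition obtained by making `b` a block of its own. -/
def isolate (s : Setoid (Fin n)) (b : Fin n) : Setoid (Fin n) where
  r u v := u = v ∨ (s u v ∧ u ≠ b ∧ v ≠ b)
  iseqv :=
    { refl := fun u => Or.inl rfl
      symm := by
        rintro u v (h | ⟨h, h1, h2⟩)
        · exact Or.inl h.symm
        · exact Or.inr ⟨s.symm' h, h2, h1⟩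
      trans := by
        rintro u v w (rfl | ⟨h, h1, h2⟩) (rfl | ⟨h', h1', h2'⟩)
        · exact Or.inl rfl
        · exact Or.inr ⟨h', h1', h2'⟩
        · exact Or.inr ⟨h, h1, h2⟩
        · exact Or.inr ⟨s.trans' h h', h1, h2'⟩ }

theorem isolate_le (s : Setoid (Fin n)) (b : Fin n) : isolate s b ≤ s := by
  rintro u v (rfl | h)
  · exact s.refl' u
  · exact h.1

theorem isolate_mono {s t : Setoid (Fin n)} (h : s ≤ t) (b : Fin n) : isolate s b ≤ isolate t b := by
  rintro u v (rfl | ⟨h1, h2⟩)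
  · exact Or.inl rfl
  · exact Or.inr ⟨h h1, h2⟩

theorem eq_of_isolate_right {s : Setoid (Fin n)} {b c : Fin n} (h : isolate s b c b) : c = b := by
  rcases h with h | h
  · exact h
  · exact absurd rfl h.2.2

theorem mergeBlocks_isolate {s : Setoid (Fin n)} {a b : Fin n} (hab : s a b) (hne : a ≠ b) :
    mergeBlocks (isolate s b) a b = s := by
  refine le_antisymm (mergeBlocks_le_iff.2 ⟨isolate_le s b, hab⟩) fun u v huv => ?_
  by_cases hu : u = b <;> by_cases hv : v = b
  · exact Or.inl (Or.inl (hu.trans hv.symm))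
  · subst hu
    exact Or.inr (Or.inr ⟨Or.inl rfl, Or.inr ⟨s.trans' (s.symm' huv) (s.symm' hab), hv, hne⟩⟩)
  · subst hv
    exact Or.inr (Or.inl ⟨Or.inr ⟨s.trans' huv (s.symm' hab), hu, hne⟩, Or.inl rfl⟩)
  · exact Or.inl (Or.inr ⟨huv, hu, hv⟩)

theorem isolate_eq_self {s : Setoid (Fin n)} {b : Fin n} (h : ∀ c, s c b → c = b) :
    isolate s b = s := by
  refine le_antisymm (isolate_le s b) fun u v huv => ?_
  by_cases hv : v = b
  · subst hv
    exact Or.inl (h u huv)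
  · by_cases hu : u = b
    · subst hu
      exact absurd (h v (s.symm' huv)) hv
    · exact Or.inr ⟨huv, hu, hv⟩

end BlockMinima

/-! ### Steps between weighted partitions -/

namespace WeightedPartition

section Steps

variable {n k : ℕ}

instance : Finite (WeightedPartition n k) := by
  refine Finite.of_injective
    (fun x : WeightedPartition n k => fun (m : Fin k) (u v : Fin n) => x.layer m u v) ?_
  intro x y h
  ext m u v
  exact iff_of_eq (congrFun (congrFun (congrFun h m) u) v)

/-- The result of merging the blocks of `a` and `b` in the layers `m ≤ l`. -/
def merge (x : WeightedPartition n k) (a b : Fin n) (l : Fin k) : WeightedPartition n k where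
  layer m := if m ≤ l then mergeBlocks (x.layer m) a b else x.layer m
  antitone := by
    intro m m' hm
    dsimp only
    by_cases h' : m' ≤ l
    · rw [if_pos h', if_pos (hm.trans h')]
      exact mergeBlocks_le_iff.2 ⟨(x.antitone hm).trans (le_mergeBlocks _ _ _),
        mergeBlocks_rel _ _ _⟩
    · rw [if_neg h']
      split_ifs
      · exact (x.antitone hm).trans (le_mergeBlocks _ _ _)
      · exact x.antitone hm

variable [NeZero k]

theorem layer_le_zero (x : WeightedPartition n k) (m : Fin k) : x.layer m ≤ x.layer 0 :=
  x.antitone (Fin.zero_le m)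

theorem admissible_merge {x : WeightedPartition n k} {a b : Fin n} {l : Fin k} (hab : a < b)
    (hne : ¬ x.layer 0 a b) (ha : IsBlockMin (x.layer l) a) (hb : IsBlockMin (x.layer 0) b) :
    Admissible x a b l (x.merge a b l) where
  lt := hab
  ne_first := hne
  least_first := hb
  ne_layer h := hne (x.layer_le_zero l h)
  least_left := ha
  least_right := hb.of_le (x.layer_le_zero l)
  layer_of_le _ hm := if_pos hm
  layer_of_lt _ hm := if_neg hm.not_ge

namespace Admissible

variable {x y z w : WeightedPartition n k} {a b : Fin n} {l : Fin k}

theorem eq_merge (h : Admissible x a b l y) : y = x.merge a b l := by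
  ext1
  funext m
  by_cases hm : m ≤ l
  · rw [h.layer_of_le m hm]
    exact (if_pos hm).symm
  · rw [h.layer_of_lt m (not_le.1 hm)]
    exact (if_neg hm).symm

theorem layer_le (h : Admissible x a b l y) (m : Fin k) : x.layer m ≤ y.layer m := by
  by_cases hm : m ≤ l
  · rw [h.layer_of_le m hm]
    exact le_mergeBlocks _ _ _
  · rw [h.layer_of_lt m (not_le.1 hm)]

/-- A step labelled `(a, b)_l` destroys exactly one block minimum in each of the layers `m ≤ l`,
namely `b`. -/
theorem isBlockMin_iff (h : Admissible x a b l y) (m : Fin k) (c : Fin n) :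
    IsBlockMin (y.layer m) c ↔ IsBlockMin (x.layer m) c ∧ (m ≤ l → c ≠ b) := by
  by_cases hm : m ≤ l
  · have hb : IsBlockMin (x.layer m) b := IsBlockMin.of_le (x.layer_le_zero m) h.least_first
    rw [h.layer_of_le m hm, isBlockMin_mergeBlocks_iff h.lt hb]
    simp [hm]
  · rw [h.layer_of_lt m (not_le.1 hm)]
    simp [hm]

theorem isBlockMin_zero_iff (h : Admissible x a b l y) (c : Fin n) :
    IsBlockMin (y.layer 0) c ↔ IsBlockMin (x.layer 0) c ∧ c ≠ b := by
  rw [h.isBlockMin_iff]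
  simp

/-- Two consecutive steps can be interchanged, the second keeping its label; only the smaller
element of the label of the first may have to be replaced. -/
theorem swap {a₁ b₁ : Fin n} {l₁ : Fin k} (h₁ : Admissible x a₁ b₁ l₁ z)
    (h : Admissible z a b l w) :
    ∃ z' a₁', Admissible x a b l z' ∧ Admissible z' a₁' b₁ l₁ w := by
  have hx : ∀ m, x.layer m ≤ z.layer m := h₁.layer_le
  obtain ⟨z', hz'⟩ : ∃ z', Admissible x a b l z' :=
    ⟨_, admissible_merge h.lt (fun h' => h.ne_first (hx 0 h'))
      (IsBlockMin.of_le (hx l) h.least_left) (IsBlockMin.of_le (hx 0) h.least_first)⟩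
  -- merging with `a` may have destroyed the minimum `a₁` of its block in layer `l₁`
  obtain ⟨a₁', hrel, hmin, hle⟩ := exists_isBlockMin (z'.layer l₁) a₁
  have hb₁b : b₁ ≠ b := fun he =>
    ((h₁.isBlockMin_zero_iff b).1 h.least_first).2 he.symm
  have hb₁ : IsBlockMin (z'.layer 0) b₁ :=
    (hz'.isBlockMin_zero_iff b₁).2 ⟨h₁.least_first, hb₁b⟩
  have hne : ¬ z'.layer 0 a₁' b₁ := by
    intro h'
    have h2 : z'.layer 0 a₁ b₁ :=
      (z'.layer 0).trans' ((z'.layer 0).symm' (z'.layer_le_zero l₁ hrel)) h'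
    rw [hz'.layer_of_le 0 (Fin.zero_le l)] at h2
    have hz0 := h₁.layer_of_le 0 (Fin.zero_le l₁)
    rcases h2 with h2 | ⟨h2, h3⟩ | ⟨h2, h3⟩
    · exact h₁.ne_first h2
    · apply h.ne_first
      rw [hz0]
      exact Or.inr (Or.inl ⟨(x.layer 0).symm' h2, (x.layer 0).symm' h3⟩)
    · apply h.ne_first
      rw [hz0]
      exact Or.inr (Or.inr ⟨(x.layer 0).symm' h3, (x.layer 0).symm' h2⟩)
  refine ⟨z', a₁', hz', ⟨hle.trans_lt h₁.lt, hne, hb₁, fun h' => hne (z'.layer_le_zero l₁ h'),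
    hmin, hb₁.of_le (z'.layer_le_zero l₁), fun m hm => ?_, fun m hm => ?_⟩⟩
  · rw [mergeBlocks_congr_left (z'.antitone hm hrel)]
    by_cases hml : m ≤ l
    · rw [h.layer_of_le m hml, h₁.layer_of_le m hm, hz'.layer_of_le m hml, mergeBlocks_comm]
    · rw [h.layer_of_lt m (not_le.1 hml), h₁.layer_of_le m hm, hz'.layer_of_lt m (not_le.1 hml)]
  · by_cases hml : m ≤ l
    · rw [h.layer_of_le m hml, h₁.layer_of_lt m hm, hz'.layer_of_le m hml]
    · rw [h.layer_of_lt m (not_le.1 hml), h₁.layer_of_lt m hm, hz'.layer_of_lt m (not_le.1 hml)]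

end Admissible

theorem Step.le {x y : WeightedPartition n k} (h : Step x y) : x ≤ y :=
  Relation.ReflTransGen.single h

theorem Admissible.le {x y : WeightedPartition n k} {a b : Fin n} {l : Fin k}
    (h : Admissible x a b l y) : x ≤ y := Step.le ⟨a, b, l, h⟩

theorem layer_mono {x y : WeightedPartition n k} (h : x ≤ y) (m : Fin k) :
    x.layer m ≤ y.layer m := by
  induction (show Relation.ReflTransGen Step x y from h) with
  | refl => exact le_rfl
  | tail _ hs ih =>
    obtain ⟨a, b, l, hs⟩ := hs
    exact (ih (by assumption)).trans (hs.layer_le m)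

/-- Only minima of blocks of the first layer lose their role as a block minimum in some layer. -/
theorem isBlockMin_of_le {x y : WeightedPartition n k} (h : x ≤ y) {b : Fin n} {m : Fin k}
    (h0 : ¬ IsBlockMin (x.layer 0) b) (hm : IsBlockMin (x.layer m) b) :
    IsBlockMin (y.layer m) b := by
  have h' : Relation.ReflTransGen Step x y := h
  induction h' using Relation.ReflTransGen.head_induction_on with
  | refl => exact hm
  | head hs hle ih =>
    obtain ⟨a, b', l, hs⟩ := hs
    refine ih hle (fun h => h0 ((hs.isBlockMin_zero_iff b).1 h).1)
      ((hs.isBlockMin_iff m b).2 ⟨hm, fun _ he => h0 ?_⟩)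
    rw [he]
    exact hs.least_first

/-- If `b` is a minimum of a block in the first layer of `x` but not of `y ≥ x`, then some chain
from `x` to `y` starts by merging the block of `b`. -/
theorem exists_admissible_of_le {x y : WeightedPartition n k} (h : x ≤ y) {b : Fin n}
    (hx : IsBlockMin (x.layer 0) b) (hy : ¬ IsBlockMin (y.layer 0) b) :
    ∃ a l z, Admissible x a b l z ∧ z ≤ y := by
  have h' : Relation.ReflTransGen Step x y := h
  induction h' using Relation.ReflTransGen.head_induction_on with
  | refl => exact absurd hx hy
  | head hs hle ih =>
    obtain ⟨a₁, b₁, l₁, hs⟩ := hs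
    by_cases hb : b = b₁
    · subst hb
      exact ⟨a₁, l₁, _, hs, hle⟩
    · obtain ⟨a, l, w, hw, hwy⟩ := ih hle ((hs.isBlockMin_zero_iff b).2 ⟨hx, hb⟩)
      obtain ⟨z', a₁', h1, h2⟩ := hs.swap hw
      exact ⟨a, l, z', h1, h2.le.trans hwy⟩

end Steps

end WeightedPartition

/-! ### Ranks and covering relations -/

section Rank

namespace WeightedPartition

variable {n k : ℕ} [NeZero k]

theorem rank_eq (x : WeightedPartition n k) :
    x.rank = n - {b | IsBlockMin (x.layer 0) b}.ncard := by
  rw [rank, card_quotient_eq_ncard]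

theorem ncard_setOf_isBlockMin_le (s : Setoid (Fin n)) : {b | IsBlockMin s b}.ncard ≤ n := by
  have := Set.ncard_le_ncard (Set.subset_univ {b | IsBlockMin s b}) (Set.toFinite _)
  rwa [Set.ncard_univ, Nat.card_fin] at this

theorem Admissible.rank_eq {x y : WeightedPartition n k} {a b : Fin n} {l : Fin k}
    (h : Admissible x a b l y) : y.rank = x.rank + 1 := by
  have hset : {c | IsBlockMin (y.layer 0) c} = {c | IsBlockMin (x.layer 0) c} \ {b} :=
    Set.ext fun c => h.isBlockMin_zero_iff c
  have hcard := Set.ncard_sdiff_singleton_add_one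
    (show b ∈ {c | IsBlockMin (x.layer 0) c} from h.least_first) (Set.toFinite _)
  have := ncard_setOf_isBlockMin_le (x.layer 0)
  rw [WeightedPartition.rank_eq, WeightedPartition.rank_eq, hset]
  omega

theorem rank_mono {x y : WeightedPartition n k} (h : x ≤ y) : x.rank ≤ y.rank := by
  induction (show Relation.ReflTransGen Step x y from h) with
  | refl => exact le_rfl
  | tail hxy hs ih =>
    obtain ⟨a, b, l, hs⟩ := hs
    have := ih hxy
    have := hs.rank_eq
    omega

theorem exists_step_of_lt {x y : WeightedPartition n k} (h : x < y) : ∃ z, Step x z ∧ z ≤ y := by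
  rcases Relation.ReflTransGen.cases_head (show Relation.ReflTransGen Step x y from h.le) with
    rfl | ⟨z, hs, hz⟩
  · exact absurd h (lt_irrefl _)
  · exact ⟨z, hs, hz⟩

theorem rank_strictMono {x y : WeightedPartition n k} (h : x < y) : x.rank < y.rank := by
  obtain ⟨z, ⟨a, b, l, hs⟩, hz⟩ := exists_step_of_lt h
  have := hs.rank_eq
  have := rank_mono hz
  omega

theorem covBy_iff_step {x y : WeightedPartition n k} : x ⋖ y ↔ Step x y := by
  constructor
  · intro h
    obtain ⟨z, hs, hz⟩ := exists_step_of_lt h.lt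
    rcases hz.eq_or_lt with rfl | hlt
    · exact hs
    · obtain ⟨a, b, l, ha⟩ := hs
      have hxz : x < z := lt_of_le_of_ne ha.le (by rintro rfl; have := ha.rank_eq; omega)
      exact absurd hlt (h.2 hxz)
  · rintro ⟨a, b, l, h⟩
    refine ⟨lt_of_le_of_ne h.le (by rintro rfl; have := h.rank_eq; omega), fun z h1 h2 => ?_⟩
    have := rank_strictMono h1
    have := rank_strictMono h2
    have := h.rank_eq
    omega

variable [NeZero n]

theorem isBlockMin_zero (s : Setoid (Fin n)) : IsBlockMin s 0 := fun c _ => Fin.zero_le c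

/-- Merging the block of `1` with the block of the minimum `b` in all layers is always allowed. -/
theorem admissible_zero (x : WeightedPartition n k) {b : Fin n}
    (hb : IsBlockMin (x.layer 0) b) (h0 : b ≠ 0) :
    Admissible x 0 b ⊤ (x.merge 0 b ⊤) :=
  admissible_merge (Fin.pos_iff_ne_zero.2 h0)
    (fun h => h0 ((isBlockMin_zero _).eq hb h).symm) (isBlockMin_zero _) hb

theorem rank_add_one_eq_iff (x : WeightedPartition n k) :
    x.rank + 1 = n ↔ ∀ b, IsBlockMin (x.layer 0) b → b = 0 := by
  have hle := ncard_setOf_isBlockMin_le (x.layer 0)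
  have hpos : 0 < {b | IsBlockMin (x.layer 0) b}.ncard :=
    (Set.ncard_pos (Set.toFinite _)).2 ⟨0, isBlockMin_zero _⟩
  have h1 : x.rank + 1 = n ↔ {b | IsBlockMin (x.layer 0) b}.ncard ≤ 1 := by
    rw [WeightedPartition.rank_eq]
    omega
  rw [h1, Set.ncard_le_one (Set.toFinite _)]
  exact ⟨fun h b hb => h b hb 0 (isBlockMin_zero _),
    fun h a ha b hb => (h a ha).trans (h b hb).symm⟩

theorem isMax_iff (x : WeightedPartition n k) : IsMax x ↔ x.rank + 1 = n := by
  rw [rank_add_one_eq_iff]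
  constructor
  · intro h b hb
    by_contra h0
    have hadm := x.admissible_zero hb h0
    have := rank_mono (h hadm.le)
    have := hadm.rank_eq
    omega
  · intro h y hxy
    by_contra hyx
    obtain ⟨z, ⟨a, b, l, hs⟩, -⟩ := exists_step_of_lt (lt_of_le_not_ge hxy hyx)
    exact absurd (h b hs.least_first) (Fin.pos_iff_ne_zero.1 ((Fin.zero_le a).trans_lt hs.lt))

end WeightedPartition

end Rank

/-! ### Final labels -/

section FinalLabels

namespace WeightedPartition

variable {n k : ℕ}

/-- The least weighted partition: all blocks of all layers are singletons. -/
def discrete : WeightedPartition n k where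
  layer _ := ⊥
  antitone _ _ _ := le_rfl

/-- The label `(a, b)_l` that merging the block of `b` receives in the rising chains ending in
`y`: `l` is the last layer of `y` in which `b` is not the least element of its block, and `a` is
the least element of that block. -/
structure FinalLabel (y : WeightedPartition n k) (a b : Fin n) (l : Fin k) : Prop where
  lt : a < b
  rel : y.layer l a b
  isBlockMin_left : IsBlockMin (y.layer l) a
  isBlockMin_right : ∀ m, l < m → IsBlockMin (y.layer m) b

theorem FinalLabel.unique {y : WeightedPartition n k} {a a' b : Fin n} {l l' : Fin k}
    (h : FinalLabel y a b l) (h' : FinalLabel y a' b l') : a = a' ∧ l = l' := by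
  have hl : l = l' := by
    rcases lt_trichotomy l l' with hlt | heq | hlt
    · exact absurd (h.isBlockMin_right l' hlt) (not_isBlockMin h'.rel h'.lt)
    · exact heq
    · exact absurd (h'.isBlockMin_right l hlt) (not_isBlockMin h.rel h.lt)
  subst hl
  exact ⟨h.isBlockMin_left.eq h'.isBlockMin_left
    ((y.layer l).trans' h.rel ((y.layer l).symm' h'.rel)), rfl⟩

variable [NeZero k]

theorem FinalLabel.not_isBlockMin_zero {y : WeightedPartition n k} {a b : Fin n} {l : Fin k}
    (h : FinalLabel y a b l) : ¬ IsBlockMin (y.layer 0) b :=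
  not_isBlockMin (y.layer_le_zero l h.rel) h.lt

theorem exists_finalLabel (y : WeightedPartition n k) {b : Fin n}
    (hb : ¬ IsBlockMin (y.layer 0) b) : ∃ a l, FinalLabel y a b l := by
  obtain ⟨l, hl, hmax⟩ := WellFounded.has_min (wellFounded_gt (α := Fin k))
    {m | ¬ IsBlockMin (y.layer m) b} ⟨0, hb⟩
  obtain ⟨a, hab, ha, hle⟩ := exists_isBlockMin (y.layer l) b
  refine ⟨a, l, lt_of_le_of_ne hle ?_, hab, ha, fun m hm => ?_⟩
  · rintro rfl
    exact hl ha
  · by_contra h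
    exact hmax m h hm

/-- The label of a step `x → z` agrees with the final label in `y ≥ z`, up to the smaller element,
which may lie above the one of the final label. -/
theorem Admissible.exists_finalLabel {x y z : WeightedPartition n k} {a b : Fin n} {l : Fin k}
    (h : Admissible x a b l z) (hzy : z ≤ y) :
    ∃ a', FinalLabel y a' b l ∧ a' ≤ a ∧ y.layer l a' a := by
  obtain ⟨a', hrel, hmin, hle⟩ := exists_isBlockMin (y.layer l) a
  have hab : z.layer l a b := by
    rw [h.layer_of_le l le_rfl]
    exact mergeBlocks_rel _ _ _
  refine ⟨a', ⟨hle.trans_lt h.lt, (y.layer l).trans' hrel (layer_mono hzy l hab), hmin,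
    fun m hm => ?_⟩, hle, hrel⟩
  refine isBlockMin_of_le hzy (fun h0 => ((h.isBlockMin_zero_iff b).1 h0).2 rfl)
    ((h.isBlockMin_iff m b).2 ⟨?_, fun h' => absurd hm h'.not_gt⟩)
  exact IsBlockMin.of_le (x.layer_le_zero m) h.least_first

theorem Admissible.finalLabel {x y : WeightedPartition n k} {a b : Fin n} {l : Fin k}
    (h : Admissible x a b l y) : FinalLabel y a b l := by
  obtain ⟨a', hf, -, hrel⟩ := h.exists_finalLabel le_rfl
  have ha : IsBlockMin (y.layer l) a := (h.isBlockMin_iff l a).2 ⟨h.least_left, fun _ => h.lt.ne⟩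
  rwa [hf.isBlockMin_left.eq ha hrel] at hf

/-- A covering relation carries only one label. -/
theorem Admissible.label_unique {x y : WeightedPartition n k} {a a' b b' : Fin n} {l l' : Fin k}
    (h : Admissible x a b l y) (h' : Admissible x a' b' l' y) : a = a' ∧ b = b' ∧ l = l' := by
  have hb : b = b' := by
    by_contra hne
    exact ((h.isBlockMin_zero_iff b).1 ((h'.isBlockMin_zero_iff b).2 ⟨h.least_first, hne⟩)).2 rfl
  subst hb
  obtain ⟨h1, h2⟩ := h.finalLabel.unique h'.finalLabel
  exact ⟨h1, rfl, h2⟩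

/-- Every weighted partition other than the discrete one is the target of a step: the largest
element which is not a block minimum in the first layer is the largest element of its blocks, and
can be split off. -/
theorem exists_step_to (x : WeightedPartition n k) (hx : x ≠ discrete) : ∃ z, Step z x := by
  have hex : ∃ b, ¬ IsBlockMin (x.layer 0) b := by
    by_contra! hall
    refine hx (WeightedPartition.ext (funext fun m => le_bot_iff.1 fun u v huv => ?_))
    exact (hall u).eq (hall v) (x.layer_le_zero m huv)
  obtain ⟨b, hb, hmax⟩ := WellFounded.has_min (wellFounded_gt (α := Fin n))
    {b | ¬ IsBlockMin (x.layer 0) b} hex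
  have hle : ∀ m c, x.layer m c b → c ≤ b := by
    intro m c hc
    by_contra hlt
    have hmin : IsBlockMin (x.layer 0) c := not_not.1 fun h => hmax c h (not_le.1 hlt)
    exact hlt (hmin b ((x.layer 0).symm' (x.layer_le_zero m hc)))
  obtain ⟨a, l, hf⟩ := x.exists_finalLabel hb
  have hnot : ∀ s : Setoid (Fin n), ¬ isolate s b a b := fun s h =>
    hf.lt.ne (eq_of_isolate_right h)
  refine ⟨⟨fun m => isolate (x.layer m) b, fun m m' h => isolate_mono (x.antitone h) b⟩, a, b, l,
    hf.lt, hnot _, fun c hc => (eq_of_isolate_right hc).ge, hnot _,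
    fun c hc => hf.isBlockMin_left c (isolate_le _ b hc),
    fun c hc => (eq_of_isolate_right hc).ge, fun m hm => ?_, fun m hm => ?_⟩
  · exact (mergeBlocks_isolate (x.antitone hm hf.rel) hf.lt.ne).symm
  · exact (isolate_eq_self fun c hc =>
      le_antisymm (hle m c hc) (hf.isBlockMin_right m hm c hc)).symm

theorem discrete_le (x : WeightedPartition n k) : discrete ≤ x := by
  induction h : x.rank using Nat.strong_induction_on generalizing x with
  | _ r ih =>
  by_cases hx : x = discrete
  · exact hx.ge
  · obtain ⟨z, hz⟩ := x.exists_step_to hx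
    obtain ⟨a, b, l, hs⟩ := id hz
    have := hs.rank_eq
    exact (ih z.rank (by omega) z rfl).trans hz.le

theorem rank_discrete : (discrete : WeightedPartition n k).rank = 0 := by
  have : {b | IsBlockMin ((discrete : WeightedPartition n k).layer 0) b} = Set.univ := by
    refine Set.eq_univ_of_forall fun b c hc => ?_
    have : c = b := hc
    exact this.ge
  rw [rank_eq, this, Set.ncard_univ, Nat.card_fin, Nat.sub_self]

end WeightedPartition

end FinalLabels

/-! ### The labeling of the poset of weighted partitions -/

section Labels

theorem EdgeLabel.mk_le_mk {a b l a' b' l' : ℕ} :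
    EdgeLabel.mk a b l ≤ EdgeLabel.mk a' b' l' ↔
      l' < l ∨ l = l' ∧ (a < a' ∨ a = a' ∧ b ≤ b') := by
  simp [EdgeLabel.mk, Prod.Lex.toLex_le_toLex]

theorem EdgeLabel.mk_lt_mk {a b l a' b' l' : ℕ} :
    EdgeLabel.mk a b l < EdgeLabel.mk a' b' l' ↔
      l' < l ∨ l = l' ∧ (a < a' ∨ a = a' ∧ b < b') := by
  simp [EdgeLabel.mk, Prod.Lex.toLex_lt_toLex]

variable {n k : ℕ} [NeZero k]

open WeightedPartition

theorem hasLabel_coe_coe {x y : WeightedPartition n k} {c : EdgeLabel} :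
    HasLabel (x : LPoset n k) y c ↔ ∃ (a b : Fin n) (l : Fin k),
      Admissible x a b l y ∧ c = EdgeLabel.mk (a + 1) (b + 1) (l + 1) := Iff.rfl

theorem hasLabel_coe_top {x : WeightedPartition n k} {c : EdgeLabel} :
    HasLabel (x : LPoset n k) ⊤ c ↔ x.rank + 1 = n ∧ c = EdgeLabel.mk 1 n k := Iff.rfl

theorem not_hasLabel_top (y : LPoset n k) (c : EdgeLabel) : ¬ HasLabel ⊤ y c := id

theorem HasLabel.unique {x y : LPoset n k} {c c' : EdgeLabel} (h : HasLabel x y c)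
    (h' : HasLabel x y c') : c = c' := by
  induction x using WithTop.recTopCoe with
  | top => exact absurd h (not_hasLabel_top y c)
  | coe x =>
    induction y using WithTop.recTopCoe with
    | top => rw [(hasLabel_coe_top.1 h).2, (hasLabel_coe_top.1 h').2]
    | coe y =>
      obtain ⟨a, b, l, hs, rfl⟩ := hasLabel_coe_coe.1 h
      obtain ⟨a', b', l', hs', rfl⟩ := hasLabel_coe_coe.1 h'
      obtain ⟨rfl, rfl, rfl⟩ := hs.label_unique hs'
      rfl

theorem HasLabel.wpEdgeLabel_eq {x y : LPoset n k} {c : EdgeLabel} (h : HasLabel x y c) :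
    wpEdgeLabel n k x y = c :=
  (Classical.epsilon_spec ⟨c, h⟩ : HasLabel x y (wpEdgeLabel n k x y)).unique h

theorem wpEdgeLabel_coe_coe {x y : WeightedPartition n k} {a b : Fin n} {l : Fin k}
    (h : Admissible x a b l y) :
    wpEdgeLabel n k x y = EdgeLabel.mk (a + 1) (b + 1) (l + 1) :=
  HasLabel.wpEdgeLabel_eq (hasLabel_coe_coe.2 ⟨a, b, l, h, rfl⟩)

theorem coe_covBy_coe_iff {x y : WeightedPartition n k} :
    (x : LPoset n k) ⋖ y ↔ ∃ a b l, Admissible x a b l y :=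
  WithTop.coe_covBy_coe.trans covBy_iff_step

theorem coe_covBy_top_iff [NeZero n] {x : WeightedPartition n k} :
    (x : LPoset n k) ⋖ ⊤ ↔ x.rank + 1 = n :=
  WithTop.coe_covBy_top.trans (isMax_iff x)

theorem covBy_iff_hasLabel [NeZero n] (x y : LPoset n k) : x ⋖ y ↔ ∃ c, HasLabel x y c := by
  induction x using WithTop.recTopCoe with
  | top => exact ⟨fun h => absurd h.lt not_top_lt, fun ⟨c, h⟩ => absurd h (not_hasLabel_top y c)⟩
  | coe x =>
    induction y using WithTop.recTopCoe with
    | top =>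
      rw [coe_covBy_top_iff]
      exact ⟨fun h => ⟨_, h, rfl⟩, fun ⟨c, h⟩ => h.1⟩
    | coe y =>
      rw [coe_covBy_coe_iff]
      exact ⟨fun ⟨a, b, l, h⟩ => ⟨_, a, b, l, h, rfl⟩, fun ⟨c, a, b, l, h, _⟩ => ⟨a, b, l, h⟩⟩

theorem isBot_coe_discrete : IsBot ((discrete : WeightedPartition n k) : LPoset n k) := by
  intro y
  induction y using WithTop.recTopCoe with
  | top => exact le_top
  | coe y => exact WithTop.coe_le_coe.2 (discrete_le y)

theorem LPoset.isRankFunction_rank [NeZero n] :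
    IsRankFunction (LPoset.rank : LPoset n k → ℕ) where
  minimal x hx := by
    rw [hx.eq_of_le (isBot_coe_discrete x) |>.symm]
    exact rank_discrete
  covBy x y hxy := by
    induction x using WithTop.recTopCoe with
    | top => exact absurd hxy.lt not_top_lt
    | coe x =>
      induction y using WithTop.recTopCoe with
      | top => exact (coe_covBy_top_iff.1 hxy).symm
      | coe y =>
        obtain ⟨a, b, l, h⟩ := coe_covBy_coe_iff.1 hxy
        exact h.rank_eq

/-- The labels that occur on the rising chain of the interval `[x, y]`: for `y ≠ ⊤`, the final
labels in `y` of the minima `b` of the blocks of the first layer of `x`; for `y = ⊤`, the labels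
`(1, b)_k` of these `b ≠ 1`, and the label `(1, n)_k` of the last step. -/
def labelSet : LPoset n k → LPoset n k → Set EdgeLabel
  | some x, some y => {c | ∃ a b l, IsBlockMin (x.layer 0) b ∧ FinalLabel y a b l ∧
      c = EdgeLabel.mk (a + 1) (b + 1) (l + 1)}
  | some x, none => {c | c = EdgeLabel.mk 1 n k ∨ ∃ b : Fin n, IsBlockMin (x.layer 0) b ∧
      (b : ℕ) ≠ 0 ∧ c = EdgeLabel.mk 1 (b + 1) k}
  | none, _ => ∅

theorem mem_labelSet_coe {x y : WeightedPartition n k} {c : EdgeLabel} :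
    c ∈ labelSet (x : LPoset n k) y ↔ ∃ a b l, IsBlockMin (x.layer 0) b ∧ FinalLabel y a b l ∧
      c = EdgeLabel.mk (a + 1) (b + 1) (l + 1) := Iff.rfl

theorem mem_labelSet_top {x : WeightedPartition n k} {c : EdgeLabel} :
    c ∈ labelSet (x : LPoset n k) ⊤ ↔ c = EdgeLabel.mk 1 n k ∨ ∃ b : Fin n,
      IsBlockMin (x.layer 0) b ∧ (b : ℕ) ≠ 0 ∧ c = EdgeLabel.mk 1 (b + 1) k := Iff.rfl

theorem labelSet_mono {x y z : LPoset n k} (hxz : x ⋖ z) : labelSet z y ⊆ labelSet x y := by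
  induction x using WithTop.recTopCoe with
  | top => exact absurd hxz.lt not_top_lt
  | coe x =>
    induction z using WithTop.recTopCoe with
    | top => exact Set.empty_subset _
    | coe z =>
      obtain ⟨_, _, _, h⟩ := coe_covBy_coe_iff.1 hxz
      have hmin : ∀ b, IsBlockMin (z.layer 0) b → IsBlockMin (x.layer 0) b :=
        fun b hb => ((h.isBlockMin_zero_iff b).1 hb).1
      induction y using WithTop.recTopCoe with
      | top =>
        intro c hc
        rw [mem_labelSet_top] at hc ⊢
        exact hc.imp_right fun ⟨b, hb, h'⟩ => ⟨b, hmin b hb, h'⟩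
      | coe y =>
        rintro _ ⟨a, b, l, hb, h'⟩
        exact ⟨a, b, l, hmin b hb, h'⟩

/-- A step of an interval `[x, y]` which merges the block of the element `b` of the least label
`(a, b)_l` carries this label. For if it were `(a₁, b)_l` with `a₁ ≠ a`, then `a₁` would lose its
role as a block minimum in the layer `l` on the way to `y`, and its own label would be less. -/
theorem left_eq_of_least {x y z : WeightedPartition n k} {a a₁ b : Fin n} {l : Fin k}
    (h : Admissible x a₁ b l z) (hzy : z ≤ y) (hf : FinalLabel y a b l)
    (hleast : ∀ c ∈ labelSet (x : LPoset n k) y, EdgeLabel.mk (a + 1) (b + 1) (l + 1) ≤ c) :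
    a₁ = a := by
  obtain ⟨a', hf', hle, hrel⟩ := h.exists_finalLabel hzy
  obtain ⟨rfl, -⟩ := hf.unique hf'
  by_contra hne
  have hlt : a < a₁ := lt_of_le_of_ne hle (Ne.symm hne)
  have hxy : x ≤ y := h.le.trans hzy
  have hnot : ¬ IsBlockMin (y.layer l) a₁ := not_isBlockMin hrel hlt
  have h0 : IsBlockMin (x.layer 0) a₁ := by
    by_contra h0
    exact hnot (isBlockMin_of_le hxy h0 h.least_left)
  obtain ⟨a₂, l₂, hf₂⟩ := y.exists_finalLabel
    fun h' => hnot (IsBlockMin.of_le (y.layer_le_zero l) h')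
  have hll : l ≤ l₂ := not_lt.1 fun h' => hnot (hf₂.isBlockMin_right l h')
  have hcmp := EdgeLabel.mk_le_mk.1 (hleast _ (mem_labelSet_coe.2 ⟨a₂, a₁, l₂, h0, hf₂, rfl⟩))
  have hlt₁ := h.lt
  rcases hll.eq_or_lt with rfl | hll
  · have : a₂ = a := hf₂.isBlockMin_left.eq hf.isBlockMin_left
      ((y.layer l).trans' hf₂.rel ((y.layer l).symm' hrel))
    subst this
    simp only [Fin.lt_def] at hlt₁
    omega
  · simp only [Fin.lt_def] at hll
    omega

theorem finite_labelSet (x y : WeightedPartition n k) :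
    (labelSet (x : LPoset n k) y).Finite := by
  refine (Set.finite_range fun p : Fin n × Fin n × Fin k =>
    EdgeLabel.mk (p.1 + 1) (p.2.1 + 1) (p.2.2 + 1)).subset ?_
  rintro _ ⟨a, b, l, -, -, rfl⟩
  exact ⟨(a, b, l), rfl⟩

theorem exists_first_atom_coe {x y : WeightedPartition n k} (hxy : x < y) :
    ∃ z : LPoset n k, (x : LPoset n k) ⋖ z ∧ z ≤ y ∧
      IsLeast (labelSet (x : LPoset n k) y) (wpEdgeLabel n k x z) ∧
      ∀ z', (x : LPoset n k) ⋖ z' → z' ≤ y → z' ≠ z →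
        wpEdgeLabel n k x z < wpEdgeLabel n k x z' ∧
          (z' < y → ∃ s ∈ labelSet z' y, s < wpEdgeLabel n k x z') := by
  have hne : (labelSet (x : LPoset n k) y).Nonempty := by
    obtain ⟨z, ⟨a, b, l, h⟩, hz⟩ := exists_step_of_lt hxy
    obtain ⟨a', hf, -⟩ := h.exists_finalLabel hz
    exact ⟨_, mem_labelSet_coe.2 ⟨a', b, l, h.least_first, hf, rfl⟩⟩
  obtain ⟨c, hc, hleast⟩ := Set.exists_min_image _ id (finite_labelSet x y) hne
  simp only [id] at hleast
  obtain ⟨a, b, l, hb, hf, rfl⟩ := mem_labelSet_coe.1 hc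
  obtain ⟨a₁, l₁, z, h, hzy⟩ := exists_admissible_of_le hxy.le hb hf.not_isBlockMin_zero
  obtain ⟨a', hf', -⟩ := h.exists_finalLabel hzy
  obtain ⟨rfl, rfl⟩ := hf.unique hf'
  obtain rfl := left_eq_of_least h hzy hf hleast
  refine ⟨z, coe_covBy_coe_iff.2 ⟨_, _, _, h⟩, WithTop.coe_le_coe.2 hzy, ?_, ?_⟩
  · rw [wpEdgeLabel_coe_coe h]
    exact ⟨hc, hleast⟩
  intro z' hxz' hz'y hne'
  obtain ⟨z', rfl⟩ := WithTop.ne_top_iff_exists.1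
    (ne_top_of_le_ne_top WithTop.coe_ne_top hz'y)
  obtain ⟨a₂, b₂, l₂, h₂⟩ := coe_covBy_coe_iff.1 hxz'
  have hz'y := WithTop.coe_le_coe.1 hz'y
  obtain ⟨a₃, hf₃, hle₃, -⟩ := h₂.exists_finalLabel hz'y
  -- another atom merges another block, so that the least label remains available above it
  have hbb : b₂ ≠ b := by
    rintro rfl
    obtain ⟨rfl, rfl⟩ := hf.unique hf₃
    obtain rfl := left_eq_of_least h₂ hz'y hf hleast
    exact hne' (by rw [h.eq_merge, h₂.eq_merge])
  have hlt : EdgeLabel.mk (a₁ + 1) (b + 1) (l + 1) < EdgeLabel.mk (a₂ + 1) (b₂ + 1) (l₂ + 1) := by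
    have hcmp := EdgeLabel.mk_le_mk.1
      (hleast _ (mem_labelSet_coe.2 ⟨a₃, b₂, l₂, h₂.least_first, hf₃, rfl⟩))
    rw [EdgeLabel.mk_lt_mk]
    have : (b₂ : ℕ) ≠ b := fun h => hbb (Fin.ext h)
    have : (a₃ : ℕ) ≤ a₂ := hle₃
    omega
  rw [wpEdgeLabel_coe_coe h, wpEdgeLabel_coe_coe h₂]
  exact ⟨hlt, fun _ => ⟨_, mem_labelSet_coe.2
    ⟨a₁, b, l, (h₂.isBlockMin_zero_iff b).2 ⟨hb, hbb.symm⟩, hf, rfl⟩, hlt⟩⟩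

theorem exists_first_atom_top [NeZero n] (x : WeightedPartition n k) :
    ∃ z : LPoset n k, (x : LPoset n k) ⋖ z ∧ z ≤ ⊤ ∧
      IsLeast (labelSet (x : LPoset n k) ⊤) (wpEdgeLabel n k x z) ∧
      ∀ z', (x : LPoset n k) ⋖ z' → z' ≤ ⊤ → z' ≠ z →
        wpEdgeLabel n k x z < wpEdgeLabel n k x z' ∧
          (z' < ⊤ → ∃ s ∈ labelSet z' ⊤, s < wpEdgeLabel n k x z') := by
  by_cases hrank : x.rank + 1 = n
  · have hcov := coe_covBy_top_iff.2 hrank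
    refine ⟨⊤, hcov, le_rfl, ?_, fun z' h1 h2 h3 => absurd (lt_of_le_of_ne h2 h3) (hcov.2 h1.lt)⟩
    rw [HasLabel.wpEdgeLabel_eq (hasLabel_coe_top.2 ⟨hrank, rfl⟩)]
    refine ⟨mem_labelSet_top.2 (Or.inl rfl), fun c hc => ?_⟩
    rcases mem_labelSet_top.1 hc with rfl | ⟨b, hb, h0, -⟩
    · exact le_rfl
    · exact absurd (congrArg Fin.val ((rank_add_one_eq_iff x).1 hrank b hb)) (by simpa using h0)
  · have hex : ∃ b, IsBlockMin (x.layer 0) b ∧ b ≠ 0 := by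
      by_contra! h
      exact hrank ((rank_add_one_eq_iff x).2 h)
    obtain ⟨b, ⟨hb, h0⟩, hmin⟩ := WellFounded.has_min (wellFounded_lt (α := Fin n))
      {b | IsBlockMin (x.layer 0) b ∧ b ≠ 0} hex
    have hmin' : ∀ b', IsBlockMin (x.layer 0) b' → (b' : ℕ) ≠ 0 → (b : ℕ) ≤ b' :=
      fun b' h1 h2 => not_lt.1 (hmin b' ⟨h1, fun h => h2 (by rw [h]; rfl)⟩)
    have hadm := x.admissible_zero hb h0
    have h0' : (b : ℕ) ≠ 0 := fun h => h0 (Fin.ext h)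
    have hk : ((⊤ : Fin k) : ℕ) + 1 = k := by
      have h1 : (⟨k - 1, Nat.sub_lt (NeZero.pos k) one_pos⟩ : Fin k) ≤ ⊤ := le_top
      have h2 := (⊤ : Fin k).2
      simp only [Fin.le_def] at h1
      omega
    have hlab : wpEdgeLabel n k x (x.merge 0 b ⊤ : WeightedPartition n k) =
        EdgeLabel.mk 1 (b + 1) k := by
      rw [wpEdgeLabel_coe_coe hadm, hk]
      simp
    have hcov := coe_covBy_coe_iff.2 ⟨_, _, _, hadm⟩
    refine ⟨_, hcov, le_top, ?_, fun z' hxz' _ hne => ?_⟩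
    · rw [hlab]
      refine ⟨mem_labelSet_top.2 (Or.inr ⟨b, hb, h0', rfl⟩), fun c hc => ?_⟩
      have := b.2
      rcases mem_labelSet_top.1 hc with rfl | ⟨b', hb', h0'', rfl⟩ <;> rw [EdgeLabel.mk_le_mk]
      · omega
      · have := hmin' b' hb' h0''
        omega
    · induction z' using WithTop.recTopCoe with
      | top => exact absurd (WithTop.coe_lt_top _) (hxz'.2 hcov.lt)
      | coe z' =>
        obtain ⟨a', b', l', h'⟩ := coe_covBy_coe_iff.1 hxz'
        rw [hlab, wpEdgeLabel_coe_coe h']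
        have hlt := Fin.lt_def.1 h'.lt
        have hbb := hmin' b' h'.least_first (by omega)
        have hl' := l'.2
        have hor : (l' : ℕ) + 1 = k → (a' : ℕ) = 0 → b' ≠ b := by
          rintro h1 h2 rfl
          obtain rfl : a' = 0 := Fin.ext h2
          obtain rfl : l' = ⊤ := Fin.ext (by omega)
          exact hne (by rw [h'.eq_merge])
        have hor' : (l' : ℕ) + 1 = k → (a' : ℕ) = 0 → (b' : ℕ) ≠ b :=
          fun h1 h2 h3 => hor h1 h2 (Fin.ext h3)
        refine ⟨EdgeLabel.mk_lt_mk.2 (by omega), fun _ => ?_⟩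
        -- either the block of `b` can still be merged with that of `1`, or the last label is
        -- already too small
        by_cases hcase : (l' : ℕ) + 1 = k ∧ (a' : ℕ) = 0
        · exact ⟨_, mem_labelSet_top.2 (Or.inr ⟨b,
            (h'.isBlockMin_zero_iff b).2 ⟨hb, (hor hcase.1 hcase.2).symm⟩, h0', rfl⟩),
            EdgeLabel.mk_lt_mk.2 (by have := hor' hcase.1 hcase.2; omega)⟩
        · exact ⟨_, mem_labelSet_top.2 (Or.inl rfl), EdgeLabel.mk_lt_mk.2 (by omega)⟩

theorem isELLabeling_wpEdgeLabel [NeZero n] : IsELLabeling (wpEdgeLabel n k) := by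
  have : Finite (LPoset n k) := inferInstanceAs (Finite (Option (WeightedPartition n k)))
  refine isELLabeling_of_labelSets _ labelSet (fun x y z hxz _ => labelSet_mono hxz)
    fun x y hxy => ?_
  obtain ⟨x, rfl⟩ := WithTop.ne_top_iff_exists.1 hxy.ne_top
  induction y using WithTop.recTopCoe with
  | top => exact exists_first_atom_top x
  | coe y => exact exists_first_atom_coe (WithTop.coe_lt_coe.1 hxy)

end Labels

theorem mainTheorem1 (n k : ℕ) (hn : 1 ≤ n) [NeZero k] :
    -- the covering pairs of the poset are the labelled pairs, and the label is well defined
    (∀ x y : LPoset n k, x ⋖ y ↔ ∃ c, HasLabel x y c) ∧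
    (∀ (x y : LPoset n k) (c : EdgeLabel), HasLabel x y c → wpEdgeLabel n k x y = c) ∧
    -- the labeling is an EL-labeling
    IsELLabeling (wpEdgeLabel n k) ∧
    -- in each interval the unique rising maximal chain is lexicographically first
    (∀ (x y : LPoset n k) (c c' : List (LPoset n k)),
      IsUnrefinableChain x y c → IsRisingChain (wpEdgeLabel n k) c →
      IsUnrefinableChain x y c' → c' ≠ c →
      List.Lex (· < ·) (labelWord (wpEdgeLabel n k) c) (labelWord (wpEdgeLabel n k) c')) ∧
    -- graded, EL-shellable, shellable, Cohen–Macaulay over ℤ and over all fields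
    IsRankFunction (LPoset.rank : LPoset n k → ℕ) ∧
    IsELShellable (LPoset n k) ∧
    IsShellablePoset (LPoset n k) ∧
    IsCohenMacaulayPoset ℤ (LPoset.rank : LPoset n k → ℕ) ∧
    (∀ (F : Type*) [Field F],
      IsCohenMacaulayPoset F (LPoset.rank : LPoset n k → ℕ)) := by
  have : NeZero n := ⟨by omega⟩
  have : Finite (LPoset n k) := inferInstanceAs (Finite (Option (WeightedPartition n k)))
  have hlam : IsELLabeling (wpEdgeLabel n k) := isELLabeling_wpEdgeLabel
  have hρ : IsRankFunction (LPoset.rank : LPoset n k → ℕ) := LPoset.isRankFunction_rank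
  have htop : IsTop (⊤ : LPoset n k) := fun _ => le_top
  exact ⟨covBy_iff_hasLabel, fun _ _ _ h => h.wpEdgeLabel_eq, hlam,
    fun _ _ _ _ h1 h2 h3 h4 => hlam.lex_labelWord h1 h2 h3 h4, hρ,
    ⟨⟨inferInstance, ⟨_, isBot_coe_discrete⟩, ⟨_, htop⟩, _, hρ⟩, _, _, _, hlam⟩,
    hlam.isShellablePoset hρ isBot_coe_discrete htop, hlam.isCohenMacaulayPoset hρ ℤ,
    fun F _ => hlam.isCohenMacaulayPoset hρ F⟩
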